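/- Let $R$ be a commutative ring and $\beta\in R$ (for instance $R=\mathbb{Z}[\beta]$ with $\beta$ a formal variable), and let $x=(x_1,x_2,\ldots)$ and $y=(y_1,y_2,\ldots)$ be formal variables. Let $\lambda$ be a Young diagram (English notation, $\lambda_1$ boxes in the first row). A column-strict tableau $T$ of shape $\lambda$ is a filling of the boxes by positive integers, strictly increasing down columns and weakly increasing along rows; $\mu_k(T)$ is the number of boxes with entry $k$. A set-valued column-strict tableau $P$ of shape $\lambda$ is a filling of the boxes by nonempty finite sets of positive integers such that $\max P_{i,j}<\min P_{i',j}$ for $i<i'$ and $\max P_{i,j}\le\min P_{i,j'}$ for $j<j'$; put $\varepsilon(P)=\sum_{(i,j)\in\lambda}(|P_{i,j}|-1)$ and $\mu_k(P)=|\{(i,j)\in\lambda: k\in P_{i,j}\}|$. A reverse plane partition $Q$ of shape $\lambda$ is a filling of the boxes by positive integers, weakly increasing down columns and along rows; put $\delta(Q)=|\{(i,j)\in\lambda: (i+1,j)\in\lambda,\ Q_{i,j}=Q_{i+1,j}\}|$ and let $\nu_k(Q)$ be the number of columns of $Q$ that contain $k$. Define $$s_\lambda(x)=\sum_{T}x^{\mu(T)},\qquad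 G_\lambda(\beta,x)=\sum_{P}(-\beta)^{\varepsilon(P)}x^{\mu(P)},\qquad g_\lambda(\beta,y)=\sum_{Q}\beta^{\delta(Q)}y^{\nu(Q)},$$ where $T$, $P$, $Q$ run over all column-strict tableaux, set-valued column-strict tableaux and reverse plane partitions of shape $\lambda$. Let $w\ge 0$, and let $\mathfrak{R}(w)$ be the set of all pairs $(P,Q)$ of a set-valued column-strict tableau and a reverse plane partition of the same shape $\lambda$, with $\lambda_1=w$. Then all sums above for shapes $\lambda$ with $\lambda_1=w$, and all sums below, are well-defined formal power series over $R$ (each coefficient receives only finitely many nonzero contributions), and $$\sum_{\lambda:\ \lambda_1=w}G_\lambda(\beta,x)\,g_\lambda(\beta,y)=\sum_{\lambda:\ \lambda_1=w}s_\lambda(x)\,s_\lambda(y).$$ Moreover, both sides are equal to each of $$\sum_{(P,Q)\in\mathfrak{R}(w)}(-\beta)^{\varepsilon(P)}x^{\mu(P)}\beta^{\delta(Q)}y^{\nu(Q)},\qquad \sum_{\substack{(P,Q)\in\mathfrak{R}(w)\\ \varepsilon(P)+\delta(Q)=0}}(-\beta)^{\varepsilon(P)}x^{\mu(P)}\beta^{\delta(Q)}y^{\nu(Q)},\qquad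 \sum_{\substack{(P,Q)\in\mathfrak{R}(w)\\ \varepsilon(P)+\delta(Q)=0}}x^{\mu(P)}y^{\nu(Q)},$$ and the pairs with $\varepsilon(P)+\delta(Q)>0$ cancel: $$\sum_{\substack{(P,Q)\in\mathfrak{R}(w)\\ \varepsilon(P)+\delta(Q)>0}}(-\beta)^{\varepsilon(P)}x^{\mu(P)}\beta^{\delta(Q)}y^{\nu(Q)}=0.$$ -/

import Mathlib

open scoped MvPowerSeries.WithPiTopology

noncomputable section

namespace CauchyIdentity

/-! Boxes of a Young diagram are pairs `(i, j)` (row, column) counted from `0`, in English notation;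
so the length of the first row of `L` is `L.rowLen 0`. Alphabets are the positive natural numbers.
As in `SemistandardYoungTableau`, a filling is a function of all `(i, j)` with a fixed value
outside the diagram. -/

/-- Integer-valued column-strict tableaux of shape `L`, with positive entries. -/
def ColumnStrictTableau (L : YoungDiagram) : Type :=
  {T : SemistandardYoungTableau L // ∀ i j : ℕ, (i, j) ∈ L → 0 < T i j}

/-- Set-valued column-strict tableaux of shape `L`. -/
@[ext]
structure SetValuedTableau (L : YoungDiagram) where
  /-- the finite set in the box `(i, j)` -/
  entry : ℕ → ℕ → Finset ℕ
  /-- the boxes of `L` hold nonempty sets -/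
  nonempty : ∀ i j : ℕ, (i, j) ∈ L → (entry i j).Nonempty
  /-- of positive integers -/
  pos : ∀ i j a : ℕ, a ∈ entry i j → 0 < a
  /-- in a column, the maximum of a box is less than the minimum of every lower box -/
  col_strict : ∀ i i' j : ℕ, i < i' → (i, j) ∈ L → (i', j) ∈ L →
    ∀ a ∈ entry i j, ∀ b ∈ entry i' j, a < b
  /-- in a row, the maximum of a box is at most the minimum of every box to the right -/
  row_weak : ∀ i j j' : ℕ, j < j' → (i, j) ∈ L → (i, j') ∈ L →
    ∀ a ∈ entry i j, ∀ b ∈ entry i j', a ≤ b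
  /-- there is no entry outside of `L` -/
  empty_outside : ∀ i j : ℕ, (i, j) ∉ L → entry i j = ∅

/-- Reverse plane partitions of shape `L`, with positive entries. -/
@[ext]
structure ReversePlanePartition (L : YoungDiagram) where
  /-- the integer in the box `(i, j)` -/
  entry : ℕ → ℕ → ℕ
  /-- the entries in the boxes of `L` are positive -/
  pos : ∀ i j : ℕ, (i, j) ∈ L → 0 < entry i j
  /-- the columns are weakly increasing -/
  col_weak : ∀ i i' j : ℕ, i < i' → (i, j) ∈ L → (i', j) ∈ L → entry i j ≤ entry i' j
  /-- the rows are weakly increasing -/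
  row_weak : ∀ i j j' : ℕ, j < j' → (i, j) ∈ L → (i, j') ∈ L → entry i j ≤ entry i j'
  /-- the normalization outside of `L` -/
  zero_outside : ∀ i j : ℕ, (i, j) ∉ L → entry i j = 0

variable {L : YoungDiagram}

/-- `μ(T)`: the number of boxes with entry `k`, as a function of `k`. -/
def ColumnStrictTableau.content (T : ColumnStrictTableau L) : ℕ →₀ ℕ :=
  Finsupp.onFinset (L.cells.image fun c => T.1 c.1 c.2)
    (fun k => (L.cells.filter fun c => T.1 c.1 c.2 = k).card)
    (by
      intro k hk
      obtain ⟨c, hc⟩ := Finset.card_ne_zero.mp hk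
      rw [Finset.mem_filter] at hc
      exact Finset.mem_image.mpr ⟨c, hc.1, hc.2⟩)

/-- `μ(P)`: the number of boxes whose set contains `k`, as a function of `k`. -/
def SetValuedTableau.content (P : SetValuedTableau L) : ℕ →₀ ℕ :=
  Finsupp.onFinset (L.cells.biUnion fun c => P.entry c.1 c.2)
    (fun k => (L.cells.filter fun c => k ∈ P.entry c.1 c.2).card)
    (by
      intro k hk
      obtain ⟨c, hc⟩ := Finset.card_ne_zero.mp hk
      rw [Finset.mem_filter] at hc
      exact Finset.mem_biUnion.mpr ⟨c, hc.1, hc.2⟩)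

/-- `ε(P)`: the sum over the boxes of (number of elements) `- 1`; no subtraction truncates here,
since every box of `L` holds a nonempty set. -/
def SetValuedTableau.excess (P : SetValuedTableau L) : ℕ :=
  ∑ c ∈ L.cells, ((P.entry c.1 c.2).card - 1)

/-- `ν(Q)`: the number of columns in which `k` occurs, as a function of `k`. -/
def ReversePlanePartition.columnContent (Q : ReversePlanePartition L) : ℕ →₀ ℕ :=
  Finsupp.onFinset (L.cells.image fun c => Q.entry c.1 c.2)
    (fun k => ((L.cells.filter fun c => Q.entry c.1 c.2 = k).image Prod.snd).card)
    (by
      intro k hk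
      obtain ⟨j, hj⟩ := Finset.card_ne_zero.mp hk
      obtain ⟨c, hc, -⟩ := Finset.mem_image.mp hj
      rw [Finset.mem_filter] at hc
      exact Finset.mem_image.mpr ⟨c, hc.1, hc.2⟩)

/-- `δ(Q)`: the number of boxes of `L` whose lower neighbour is in `L` and has the same entry. -/
def ReversePlanePartition.repeats (Q : ReversePlanePartition L) : ℕ :=
  (L.cells.filter fun c =>
    (c.1 + 1, c.2) ∈ L ∧ Q.entry c.1 c.2 = Q.entry (c.1 + 1) c.2).card

section GeneratingFunctions

variable {A : Type*} [CommRing A]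

/-- `z ^ α = z₁ ^ α₁ z₂ ^ α₂ ⋯`. -/
def powMonomial (z : ℕ → A) (α : ℕ →₀ ℕ) : A :=
  α.prod fun k e => z k ^ e

variable [TopologicalSpace A]

/-- The Schur function `s_L(z)`. -/
def schur (L : YoungDiagram) (z : ℕ → A) : A :=
  ∑' T : ColumnStrictTableau L, powMonomial z T.content

/-- The generating function `G_L(b, z)` (stable Grothendieck polynomial). -/
def grothendieck (L : YoungDiagram) (b : A) (z : ℕ → A) : A :=
  ∑' P : SetValuedTableau L, (-b) ^ P.excess * powMonomial z P.content

/-- The generating function `g_L(b, z)` (dual Grothendieck polynomial). -/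
def dualGrothendieck (L : YoungDiagram) (b : A) (z : ℕ → A) : A :=
  ∑' Q : ReversePlanePartition L, b ^ Q.repeats * powMonomial z Q.columnContent

end GeneratingFunctions

/-- Formal power series over `R` in the variables `x₁, x₂, …` and `y₁, y₂, …`. (The index set has
two further elements, with index `0`; their variables occur nowhere.) -/
abbrev Series (R : Type*) : Type _ := MvPowerSeries (ℕ ⊕ ℕ) R

/-- The variable `x_k`. -/
def xVar (R : Type*) [CommRing R] (k : ℕ) : Series R := MvPowerSeries.X (Sum.inl k)

/-- The variable `y_k`. -/
def yVar (R : Type*) [CommRing R] (k : ℕ) : Series R := MvPowerSeries.X (Sum.inr k)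

/-- An element of `R`, as a constant power series. -/
def const {R : Type*} [CommRing R] (r : R) : Series R := MvPowerSeries.C r

/-- The Young diagrams whose first row has `w` boxes. -/
abbrev Diagrams (w : ℕ) : Type := {L : YoungDiagram // L.rowLen 0 = w}

/-- The pairs of a set-valued column-strict tableau and a reverse plane partition of the same
shape `L`, where the first row of `L` has `w` boxes. -/
abbrev Pairs (w : ℕ) : Type :=
  Σ L : Diagrams w, SetValuedTableau L.1 × ReversePlanePartition L.1

/-- `ε(P) + δ(Q)`. -/
def Pairs.defect {w : ℕ} (p : Pairs w) : ℕ := p.2.1.excess + p.2.2.repeats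

/-- `x ^ μ(P) * y ^ ν(Q)`. -/
def Pairs.monomial (R : Type*) [CommRing R] {w : ℕ} (p : Pairs w) : Series R :=
  powMonomial (xVar R) p.2.1.content * powMonomial (yVar R) p.2.2.columnContent

/-- `(-β) ^ ε(P) * x ^ μ(P) * (β ^ δ(Q) * y ^ ν(Q))`. -/
def Pairs.weight {R : Type*} [CommRing R] (β : R) {w : ℕ} (p : Pairs w) : Series R :=
  (-const β) ^ p.2.1.excess * powMonomial (xVar R) p.2.1.content *
    (const β ^ p.2.2.repeats * powMonomial (yVar R) p.2.2.columnContent)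

end CauchyIdentity

end

noncomputable section

namespace CauchyIdentity

open Finset

/-! A single matrix `E = elegant` satisfies both g_λ = Σ_μ E_{λμ} s_μ and s_μ = Σ_λ E_{λμ} G_λ.
Hence Σ_λ G_λ g_λ = Σ_{λ,μ} E_{λμ} G_λ s_μ = Σ_μ s_μ s_μ. Since E_{λμ} = 0 unless λ_1 = μ_1
(`elegant_hd`), the condition on the first row moves from λ to μ. In finitely many variables this is
`cauchy_list`.

Both expansions are proved one letter at a time. Adding a largest letter to a tableau is a kernel
indexed by two shapes (`rppKernel`, `svKernel`), and E intertwines each kernel with its value at β =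
0: `sum_rppKernel_mul_elegant` and `sum_elegant_mul_svKernel`. The matrix E is recursive: the first
row is kept, E is applied to the remaining rows, and a horizontal strip weighted by β is removed
from the result. After the first row is peeled off, the two relations therefore become statements
about a pair of strips. One is `twoStrips_swap`, the exchange of the letters y and β under a bound
on the first row. The other is `upperSum_eq`, a one-letter skew Cauchy identity under such a bound,
whose geometric sum is cancelled by the factor 1 - βx of `svKernel`.

Cutting off the largest letter identifies the sums over tableaux with iterated kernels (the two
lemmas `sum_weight_bounded`). Each coefficient of the power series involves only finitely many
pairs, so the finite identity suffices. Its content is that the weighted sum over all pairs does not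
depend on β; at β = 0 only the pairs of defect zero remain, and both G and g become s. -/

/-- `List.cons` on pairs, as an embedding. -/
def consEmbedding : ℕ × List ℕ ↪ List ℕ :=
  ⟨fun p => p.1 :: p.2, fun p q h => by simpa [Prod.ext_iff] using h⟩

@[simp] theorem consEmbedding_apply (p : ℕ × List ℕ) : consEmbedding p = p.1 :: p.2 := rfl

/-! ### Finite boxes of lists of row lengths -/

/-- The lists of `n` natural numbers that are at most `b`. -/
def box (b : ℕ) : ℕ → Finset (List ℕ)
  | 0 => {[]}
  | n + 1 => (range (b + 1) ×ˢ box b n).map consEmbedding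

theorem cons_mem_box {b n k : ℕ} {l : List ℕ} :
    k :: l ∈ box b (n + 1) ↔ k ≤ b ∧ l ∈ box b n := by
  simp [box]

theorem mem_box {b n : ℕ} {l : List ℕ} :
    l ∈ box b n ↔ l.length = n ∧ ∀ k ∈ l, k ≤ b := by
  induction n generalizing l with
  | zero => cases l <;> simp [box]
  | succ n ih =>
    cases l with
    | nil => simp [box]
    | cons k l => rw [cons_mem_box, ih]; simp; tauto

theorem sum_box_succ {A : Type*} [AddCommMonoid A] (b n : ℕ) (f : List ℕ → A) :
    ∑ l ∈ box b (n + 1), f l = ∑ k ∈ range (b + 1), ∑ l ∈ box b n, f (k :: l) := by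
  simp [box, sum_product]

theorem sum_box_zero {A : Type*} [AddCommMonoid A] (b : ℕ) (f : List ℕ → A) :
    ∑ l ∈ box b 0, f l = f [] := by
  simp [box]

/-- The Bender–Knuth move on one row: the end of an intermediate row is reflected in the interval of
its admissible values. -/
theorem sum_range_reflect_Icc {A : Type*} [AddCommMonoid A] {b M c : ℕ} (hc : c ≤ b)
    (f g : ℕ → A) (h : ∀ t, M ≤ t → t ≤ c → f t = g (M + c - t)) :
    ∑ t ∈ range (b + 1), (if M ≤ t ∧ t ≤ c then f t else 0) =
      ∑ t ∈ range (b + 1), (if M ≤ t ∧ t ≤ c then g t else 0) := by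
  rw [← sum_filter, ← sum_filter]
  refine sum_nbij' (fun t => M + c - t) (fun t => M + c - t) ?_ ?_ ?_ ?_ ?_ <;>
    simp only [mem_filter, mem_range]
  · intro t ht; omega
  · intro t ht; omega
  · intro t ht; omega
  · intro t ht; omega
  · intro t ht; exact h t ht.2.1 ht.2.2

/-! ### Horizontal strips and the dual Grothendieck kernel -/

section Kernels

variable {A : Type*} [CommRing A]

/-- The length of the first row. -/
def hd (l : List ℕ) : ℕ := l.headD 0

@[simp] theorem hd_nil : hd [] = 0 := rfl

@[simp] theorem hd_cons (k : ℕ) (l : List ℕ) : hd (k :: l) = k := rfl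

/-- One-variable skew Schur functions of partitions with equally many rows. -/
def strip (x : A) : List ℕ → List ℕ → A
  | [], [] => 1
  | k :: κ, s :: σ => if s ≤ k ∧ hd κ ≤ s then x ^ (k - s) * strip x κ σ else 0
  | _, _ => 0

theorem strip_hd {x : A} {κ σ : List ℕ} (h : strip x κ σ ≠ 0) : hd σ ≤ hd κ := by
  cases κ <;> cases σ <;> simp_all [strip]

/-- The two-variable sum of strips whose intermediate partition has first row at most `m`. -/
def twoStrips (b n m : ℕ) (x y : A) (κ ν : List ℕ) : A :=
  ∑ τ ∈ box b n, if hd τ ≤ m then strip x κ τ * strip y τ ν else 0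

/-- The first row `t` of the intermediate partition is constrained only to an interval, and the
second strip bounds its next row by `v`. So the sum factors, with `v` as the new bound. -/
theorem twoStrips_cons (b n m k v : ℕ) (x y : A) (κ ν : List ℕ) :
    twoStrips b (n + 1) m x y (k :: κ) (v :: ν) =
      (∑ t ∈ range (b + 1), if max v (hd κ) ≤ t ∧ t ≤ min k m then
        x ^ (k - t) * y ^ (t - v) else 0) * twoStrips b n v x y κ ν := by
  rw [twoStrips, sum_box_succ, sum_mul]
  refine sum_congr rfl fun t _ => ?_
  rw [twoStrips, mul_sum]
  refine sum_congr rfl fun τ _ => ?_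
  simp only [strip, hd_cons, max_le_iff, le_min_iff]
  by_cases h1 : t ≤ m <;> by_cases h2 : t ≤ k <;> by_cases h3 : v ≤ t <;>
    by_cases h4 : hd τ ≤ v <;> by_cases h5 : hd κ ≤ t <;> simp [h1, h2, h3, h4, h5]
  ring

/-- For `hd κ ≤ m` the bound is void and this is the symmetry of a skew Schur polynomial in two
variables. A smaller `m` shortens the interval of the first row by `hd κ - m`, which the extra
powers compensate. The proof reflects the interval of each row. -/
theorem twoStrips_swap (b n : ℕ) (x y : A) (m : ℕ) (κ ν : List ℕ) (hκ : κ ∈ box b n)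
    (hν : ν.length = n) :
    y ^ (hd κ - m) * twoStrips b n m x y κ ν = x ^ (hd κ - m) * twoStrips b n m y x κ ν := by
  induction n generalizing m κ ν with
  | zero =>
    obtain rfl : κ = [] := by simpa [box] using hκ
    obtain rfl : ν = [] := by simpa using hν
    simp [twoStrips, box, strip]
  | succ n ih =>
    obtain _ | ⟨k, κ⟩ := κ
    · simp [mem_box] at hκ
    obtain _ | ⟨v, ν⟩ := ν
    · simp at hν
    rw [cons_mem_box] at hκ
    -- The remaining factor `y ^ (hd κ - v)` is the power that the induction hypothesis needs, its
    -- bound being `v`; everything else is symmetric under reflection of `t`.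
    have key : ∀ x y : A, y ^ (k - m) * (∑ t ∈ range (b + 1),
        if max v (hd κ) ≤ t ∧ t ≤ min k m then x ^ (k - t) * y ^ (t - v) else 0) =
        (∑ t ∈ range (b + 1), if max v (hd κ) ≤ t ∧ t ≤ min k m then
          x ^ (k - m) * x ^ (min k m - t) * y ^ (k - m) * y ^ (t - max v (hd κ)) else 0) *
            y ^ (hd κ - v) := by
      intro x y
      rw [mul_sum, sum_mul]
      refine sum_congr rfl fun t _ => ?_
      split_ifs with h
      · rw [show k - t = (k - m) + (min k m - t) by omega,
          show t - v = (t - max v (hd κ)) + (hd κ - v) by omega]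
        ring
      · simp
    rw [twoStrips_cons, twoStrips_cons, hd_cons, ← mul_assoc, ← mul_assoc, key, key,
      mul_assoc, mul_assoc, ih v κ ν hκ.2 (by simpa using hν)]
    congr 1
    refine sum_range_reflect_Icc (by omega) _ _ fun t h1 h2 => ?_
    rw [show min k m - (max v (hd κ) + min k m - t) = t - max v (hd κ) by omega,
      show max v (hd κ) + min k m - t - max v (hd κ) = min k m - t by omega]
    ring

/-- The matrix that expands dual Grothendieck functions in Schur functions. -/
def elegant (b : ℕ) (β : A) : List ℕ → List ℕ → A
  | [], [] => 1
  | l :: L, m :: M => if l = m ∧ hd L ≤ l then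
      ∑ κ ∈ box b L.length, elegant b β L κ * strip β κ M else 0
  | _, _ => 0

theorem elegant_hd {b : ℕ} {β : A} {L M : List ℕ} (h : elegant b β L M ≠ 0) : hd L = hd M := by
  cases L <;> cases M <;> simp_all [elegant]

/-- This moves conditions and exponents that involve the first row across the matrix. -/
theorem elegant_mul_congr {b : ℕ} {β : A} {L M : List ℕ} {f g : A} (h : hd L = hd M → f = g) :
    elegant b β L M * f = elegant b β L M * g := by
  by_cases h0 : elegant b β L M = 0
  · simp [h0]
  · rw [h (elegant_hd h0)]

/-- One-letter dual Grothendieck functions of skew shapes. -/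
def rppKernel (β y : A) : List ℕ → List ℕ → A
  | [], [] => 1
  | l :: L, m :: M => if m ≤ l ∧ hd L ≤ l ∧ hd M ≤ m then
      β ^ (hd L - m) * y ^ (l - max m (hd L)) * rppKernel β y L M else 0
  | _, _ => 0

/-- The factor `0 ^ (hd L - m)` enforces the horizontal strip condition `hd L ≤ m`; then `hd M ≤ m`
follows from `strip_hd` whenever the rest is nonzero. -/
theorem rppKernel_zero (y : A) (L M : List ℕ) : rppKernel 0 y L M = strip y L M := by
  induction L generalizing M with
  | nil => cases M <;> rfl
  | cons l L ih =>
    obtain _ | ⟨m, M⟩ := M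
    · rfl
    simp only [rppKernel, strip, ih]
    by_cases h1 : m ≤ l ∧ hd L ≤ m
    · by_cases h0 : strip y L M = 0
      · simp [h0]
      · have := strip_hd h0
        rw [if_pos h1, if_pos (by omega), show hd L - m = 0 by omega, max_eq_left h1.2]
        simp
    · rw [if_neg h1]
      split_ifs with h2
      · rw [zero_pow (by omega)]; simp
      · rfl

/-- With the first row peeled off and the induction hypothesis applied below it, both sides are the
same sum over `κ` of two bounded strips, with the letters `y` and `β` in opposite orders. -/
theorem sum_rppKernel_mul_elegant (b n : ℕ) (β y : A) (L N : List ℕ) (hL : L ∈ box b n)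
    (hN : N ∈ box b n) :
    ∑ M ∈ box b n, rppKernel β y L M * elegant b β M N =
      ∑ M ∈ box b n, elegant b β L M * strip y M N := by
  induction n generalizing L N with
  | zero =>
    obtain rfl : L = [] := by simpa [box] using hL
    obtain rfl : N = [] := by simpa [box] using hN
    simp [box, rppKernel, elegant, strip]
  | succ n ih =>
    obtain _ | ⟨l, L⟩ := L
    · simp [mem_box] at hL
    obtain _ | ⟨v, N⟩ := N
    · simp [mem_box] at hN
    rw [cons_mem_box] at hL hN
    have hlen : L.length = n := (mem_box.1 hL.2).1
    have hlenN : N.length = n := (mem_box.1 hN.2).1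
    -- The matrix preserves the first row, so a single value of the summed first row survives on
    -- each side.
    rw [sum_box_succ, sum_box_succ, sum_eq_single v, sum_eq_single l]
    rotate_left
    · intro m _ hm
      exact sum_eq_zero fun M _ => by simp [elegant, Ne.symm hm]
    · intro h; simp at h; omega
    · intro m _ hm
      exact sum_eq_zero fun M _ => by simp [elegant, hm]
    · intro h; simp at h; omega
    by_cases hc : v ≤ l ∧ hd L ≤ l
    swap
    · rw [sum_eq_zero, sum_eq_zero]
      · intro M _
        simp only [elegant, strip]
        split_ifs <;> first | omega | simp
      · intro M _
        simp only [elegant, rppKernel]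
        split_ifs <;> first | omega | simp
    have left : ∑ M ∈ box b n, rppKernel β y (l :: L) (v :: M) * elegant b β (v :: M) (v :: N) =
        y ^ (l - max v (hd L)) * ∑ κ ∈ box b n, elegant b β L κ *
          (β ^ (hd κ - v) * twoStrips b n v y β κ N) := by
      calc _ = β ^ (hd L - v) * y ^ (l - max v (hd L)) * ∑ M ∈ box b n, ∑ κ ∈ box b n,
            rppKernel β y L M * (elegant b β M κ * if hd κ ≤ v then strip β κ N else 0) := by
            rw [mul_sum]
            refine sum_congr rfl fun M hM => ?_
            simp only [elegant, rppKernel, true_and, (mem_box.1 hM).1]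
            rw [← mul_sum]
            -- The bound on `hd M` is traded for one on `hd κ`, which leaves the sum over `M`
            -- unrestricted, as in the induction hypothesis.
            have : ∀ κ ∈ box b n, (elegant b β M κ * if hd κ ≤ v then strip β κ N else 0) =
                elegant b β M κ * if hd M ≤ v then strip β κ N else 0 :=
              fun κ _ => elegant_mul_congr fun h => by rw [h]
            rw [sum_congr rfl this]
            by_cases h : hd M ≤ v
            · simp only [h, hc, and_self, if_true]; ring
            · simp [h]
        _ = β ^ (hd L - v) * y ^ (l - max v (hd L)) * ∑ κ ∈ box b n, ∑ M ∈ box b n,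
            elegant b β L M * (strip y M κ * if hd κ ≤ v then strip β κ N else 0) := by
            rw [sum_comm]
            congr 1
            refine sum_congr rfl fun κ hκ => ?_
            simp only [← mul_assoc]
            rw [← sum_mul, ← sum_mul, ih L κ hL.2 hκ]
        _ = _ := by
            rw [sum_comm, mul_comm (β ^ _), mul_assoc, mul_sum]
            congr 1
            refine sum_congr rfl fun κ hκ => ?_
            rw [← mul_sum, mul_left_comm]
            refine elegant_mul_congr fun h => ?_
            rw [h, twoStrips]
            congr 1
            refine sum_congr rfl fun τ _ => ?_
            split_ifs <;> simp
    have right : ∑ M ∈ box b n, elegant b β (l :: L) (l :: M) * strip y (l :: M) (v :: N) =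
        y ^ (l - max v (hd L)) * ∑ κ ∈ box b n, elegant b β L κ *
          (y ^ (hd κ - v) * twoStrips b n v β y κ N) := by
      calc _ = ∑ M ∈ box b n, ∑ κ ∈ box b n, elegant b β L κ *
            (y ^ (l - v) * (if hd M ≤ v then strip β κ M * strip y M N else 0)) := by
            refine sum_congr rfl fun M hM => ?_
            simp only [elegant, strip, true_and, hlen, hc, if_true]
            rw [sum_mul]
            refine sum_congr rfl fun κ _ => ?_
            split_ifs <;> ring
        _ = _ := by
            rw [sum_comm, mul_sum]
            refine sum_congr rfl fun κ hκ => ?_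
            rw [← mul_sum, ← mul_sum, mul_left_comm (y ^ _)]
            refine elegant_mul_congr fun h => ?_
            -- Since `hd κ = hd L`, the exponents `l - max v (hd L)` and `hd κ - v` add up to `l -
            -- v`.
            rw [twoStrips, ← mul_assoc, ← pow_add, ← h]
            congr 2
            omega
    rw [left, right]
    congr 1
    refine sum_congr rfl fun κ hκ => ?_
    rw [twoStrips_swap b n y β v κ N hκ hlenN]

/-! ### The Grothendieck kernel and a bounded skew Cauchy identity -/

/-- One-letter Grothendieck functions of skew shapes, the outer shape having one more row. -/
def svKernel (β x : A) : List ℕ → List ℕ → A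
  | [l], [] => x ^ l
  | l :: L, n :: N => if n ≤ l ∧ hd L ≤ n then
      x ^ (l - n) * (if hd L < n then 1 - β * x else 1) * svKernel β x L N else 0
  | _, _ => 0

theorem svKernel_zero_cons (x : A) (k t : ℕ) (κ τ : List ℕ) :
    svKernel 0 x (k :: κ) (t :: τ) =
      if t ≤ k ∧ hd κ ≤ t then x ^ (k - t) * svKernel 0 x κ τ else 0 := by
  simp [svKernel]

/-- The sum over the partitions that contain two given ones and have first row at most `e`. -/
def upperSum (b n e : ℕ) (x y : A) (τ ρ : List ℕ) : A :=
  ∑ κ ∈ box b (n + 1), if hd κ ≤ e then svKernel 0 x κ τ * strip y κ ρ else 0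

/-- The sum over the partitions that are contained in two given ones. -/
def lowerSum (b n : ℕ) (x y : A) (τ ρ : List ℕ) : A :=
  ∑ σ ∈ box b n, svKernel 0 x ρ σ * strip y τ σ

/-- Both skew conditions bound the second row of the outer partition, one by `t` and one by `r`;
this gives the bound `min t r`. -/
theorem upperSum_cons (b n e t r : ℕ) (x y : A) (τ ρ : List ℕ) :
    upperSum b (n + 1) e x y (t :: τ) (r :: ρ) =
      (∑ k ∈ range (b + 1), if max r t ≤ k ∧ k ≤ e then x ^ (k - t) * y ^ (k - r) else 0) *
        upperSum b n (min t r) x y τ ρ := by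
  rw [upperSum, sum_box_succ, sum_mul]
  refine sum_congr rfl fun k _ => ?_
  rw [upperSum, mul_sum]
  refine sum_congr rfl fun κ _ => ?_
  simp only [strip, svKernel_zero_cons, hd_cons, max_le_iff, le_min_iff]
  by_cases h1 : k ≤ e <;> by_cases h2 : t ≤ k <;> by_cases h3 : r ≤ k <;>
    by_cases h4 : hd κ ≤ t <;> by_cases h5 : hd κ ≤ r <;> simp [h1, h2, h3, h4, h5]
  ring

/-- The part of the longer first row beyond the shorter one lies outside every common inner
partition and gives the prefactor. -/
theorem lowerSum_cons (b n t r : ℕ) (x y : A) (τ ρ : List ℕ) :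
    lowerSum b (n + 1) x y (t :: τ) (r :: ρ) =
      x ^ (r - min t r) * y ^ (t - min t r) *
        ((∑ s ∈ range (b + 1), if max (hd ρ) (hd τ) ≤ s ∧ s ≤ min t r then
          (x * y) ^ (min t r - s) else 0) * lowerSum b n x y τ ρ) := by
  rw [lowerSum, sum_box_succ, sum_mul, mul_sum]
  refine sum_congr rfl fun s _ => ?_
  rw [lowerSum, mul_sum, mul_sum]
  refine sum_congr rfl fun σ _ => ?_
  simp only [strip, svKernel_zero_cons, max_le_iff]
  by_cases h1 : s ≤ r ∧ hd ρ ≤ s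
  · by_cases h2 : s ≤ t ∧ hd τ ≤ s
    · rw [if_pos h1, if_pos h2, if_pos (by omega),
        show r - s = (r - min t r) + (min t r - s) by omega,
        show t - s = (t - min t r) + (min t r - s) by omega]
      ring
    · rw [if_neg h2, mul_zero, if_neg (by omega)]; ring
  · rw [if_neg h1, zero_mul, if_neg (by omega)]; ring

/-- Reflection matches each row of the outer partition after the first with the preceding row of the
inner one, both ranging over the same interval. The first outer row has no partner and leaves the
geometric sum. -/
theorem upperSum_eq (b n e : ℕ) (he : e ≤ b) (x y : A) (τ ρ : List ℕ)
    (hτ : τ.length = n) (hρ : ρ ∈ box b (n + 1)) :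
    upperSum b n e x y τ ρ =
      (∑ s ∈ range (b + 1), if max (hd ρ) (hd τ) ≤ s ∧ s ≤ e then (x * y) ^ (e - s) else 0) *
        lowerSum b n x y τ ρ := by
  induction n generalizing e τ ρ with
  | zero =>
    obtain rfl : τ = [] := by simpa using hτ
    obtain _ | ⟨r, ρ⟩ := ρ
    · simp [mem_box] at hρ
    rw [cons_mem_box] at hρ
    obtain rfl : ρ = [] := by simpa [box] using hρ.2
    have : upperSum b 0 e x y [] [r] =
        ∑ k ∈ range (b + 1), if r ≤ k ∧ k ≤ e then x ^ k * y ^ (k - r) else 0 := by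
      rw [upperSum, sum_box_succ]
      refine sum_congr rfl fun k _ => ?_
      by_cases h1 : r ≤ k <;> by_cases h2 : k ≤ e <;>
        simp [sum_box_zero, svKernel, strip, h1, h2]
    rw [this, sum_range_reflect_Icc he _ (fun t => x ^ r * (x * y) ^ (e - t)), sum_mul]
    · refine sum_congr rfl fun k _ => ?_
      by_cases h1 : r ≤ k <;> by_cases h2 : k ≤ e <;>
        simp [lowerSum, sum_box_zero, svKernel, strip, h1, h2]
      ring
    · intro t h1 h2
      rw [mul_pow, show e - (r + e - t) = t - r by omega, ← mul_assoc, ← pow_add]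
      congr 2; omega
  | succ n ih =>
    obtain _ | ⟨r, ρ⟩ := ρ
    · simp [mem_box] at hρ
    obtain _ | ⟨t, τ⟩ := τ
    · simp at hτ
    rw [cons_mem_box] at hρ
    rw [upperSum_cons, lowerSum_cons, ← ih (min t r) (by omega) τ ρ (by simpa using hτ) hρ.2,
      ← mul_assoc, hd_cons, hd_cons]
    congr 1
    rw [sum_range_reflect_Icc he _
      (fun s => (x * y) ^ (e - s) * (x ^ (r - min t r) * y ^ (t - min t r)))]
    · rw [mul_comm, sum_mul]
      refine sum_congr rfl fun k _ => ?_
      split_ifs <;> simp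
    · intro k h1 h2
      rw [mul_pow, show e - (max r t + e - k) = k - max r t by omega,
        show k - t = (k - max r t) + (r - min t r) by omega,
        show k - r = (k - max r t) + (t - min t r) by omega]
      ring

/-- For positive `q` the weight turns the sum into the difference of `upperSum` with bound `q` and
`x * y` times `upperSum` with bound `q - 1`; the two geometric sums differ by one term. -/
theorem sum_svKernel_mul_strip (b n q : ℕ) (hq : q ≤ b) (x y : A) (τ ρ : List ℕ)
    (hτ : τ.length = n) (hρ : ρ ∈ box b (n + 1)) :
    (∑ κ ∈ box b (n + 1), if hd κ ≤ q then (if hd κ < q then 1 - y * x else 1) *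
      (svKernel 0 x κ τ * strip y κ ρ) else 0) =
      if max (hd ρ) (hd τ) ≤ q then lowerSum b n x y τ ρ else 0 := by
  -- For `q = 0` the case `hd κ < q` does not occur, so no second sum is subtracted.
  obtain _ | q := q
  · have := upperSum_eq b n 0 hq x y τ ρ hτ hρ
    rw [sum_eq_single 0] at this
    · simpa [upperSum] using this
    · intro s _ hs
      rw [if_neg (by omega)]
    · simp
  · have : (∑ κ ∈ box b (n + 1), if hd κ ≤ q + 1 then (if hd κ < q + 1 then 1 - y * x else 1) *
        (svKernel 0 x κ τ * strip y κ ρ) else 0) =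
        upperSum b n (q + 1) x y τ ρ - x * y * upperSum b n q x y τ ρ := by
      rw [upperSum, upperSum, mul_sum, ← sum_sub_distrib]
      refine sum_congr rfl fun κ _ => ?_
      by_cases h1 : hd κ ≤ q
      · rw [if_pos (by omega), if_pos (by omega), if_pos (by omega), if_pos h1]
        ring
      · by_cases h2 : hd κ ≤ q + 1
        · rw [if_pos h2, if_neg (by omega), if_pos h2, if_neg h1]
          ring
        · rw [if_neg h2, if_neg h2, if_neg h1]
          ring
    rw [this, upperSum_eq b n _ hq x y τ ρ hτ hρ, upperSum_eq b n q (by omega) x y τ ρ hτ hρ,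
      ← mul_assoc, ← sub_mul, mul_sum, ← sum_sub_distrib, sum_eq_single (q + 1)]
    · simp
    · intro s _ hs
      by_cases h : max (hd ρ) (hd τ) ≤ s ∧ s ≤ q
      · rw [if_pos (by omega), if_pos h, show q + 1 - s = (q - s) + 1 by omega, pow_succ']
        ring
      · rw [if_neg (by omega), if_neg h]; ring
    · intro h; simp at h; omega

/-- The first row is peeled off as on the dual side. The factor `1 - β * x` attached to it lets
`sum_svKernel_mul_strip` replace a sum over larger partitions by one over smaller partitions, which
is what the other side contains. -/
theorem sum_elegant_mul_svKernel (b n : ℕ) (β x : A) (M N : List ℕ) (hM : M ∈ box b (n + 1))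
    (hN : N ∈ box b n) :
    ∑ L ∈ box b (n + 1), elegant b β L M * svKernel β x L N =
      ∑ L ∈ box b n, svKernel 0 x M L * elegant b β N L := by
  induction n generalizing M N with
  | zero =>
    obtain rfl : N = [] := by simpa [box] using hN
    obtain _ | ⟨m, M⟩ := M
    · simp [mem_box] at hM
    rw [cons_mem_box] at hM
    obtain rfl : M = [] := by simpa [box] using hM.2
    rw [sum_box_succ, sum_eq_single m]
    · simp [sum_box_zero, svKernel, elegant, strip]
    · intro k _ hk
      simp [elegant, hk]
    · intro h; simp at h; omega
  | succ n ih =>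
    obtain _ | ⟨l, M⟩ := M
    · simp [mem_box] at hM
    obtain _ | ⟨q, N⟩ := N
    · simp [mem_box] at hN
    rw [cons_mem_box] at hM hN
    have hlenN : N.length = n := (mem_box.1 hN.2).1
    rw [sum_box_succ, sum_box_succ, sum_eq_single l, sum_eq_single q]
    rotate_left
    · intro m _ hm
      exact sum_eq_zero fun M _ => by simp [elegant, Ne.symm hm]
    · intro h; simp at h; omega
    · intro m _ hm
      exact sum_eq_zero fun M _ => by simp [elegant, hm]
    · intro h; simp at h; omega
    by_cases hc : q ≤ l
    swap
    · rw [sum_eq_zero, sum_eq_zero]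
      · intro L _
        simp [svKernel, hc]
      · intro L _
        simp [svKernel, hc]
    have left : ∑ L ∈ box b (n + 1), elegant b β (l :: L) (l :: M) * svKernel β x (l :: L) (q :: N) =
        x ^ (l - q) * ∑ τ ∈ box b n, elegant b β N τ *
          if max (hd M) (hd τ) ≤ q then lowerSum b n x β τ M else 0 := by
      calc _ = x ^ (l - q) * ∑ L ∈ box b (n + 1), ∑ κ ∈ box b (n + 1),
            elegant b β L κ * svKernel β x L N *
              (strip β κ M * if hd κ ≤ q then (if hd κ < q then 1 - β * x else 1) else 0) := by
            rw [mul_sum]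
            refine sum_congr rfl fun L hL => ?_
            simp only [elegant, svKernel, true_and, (mem_box.1 hL).1, hc, mul_assoc]
            have : ∀ κ ∈ box b (n + 1), (elegant b β L κ * (svKernel β x L N *
                (strip β κ M * if hd κ ≤ q then (if hd κ < q then 1 - β * x else 1) else 0))) =
                elegant b β L κ * (svKernel β x L N *
                (strip β κ M * if hd L ≤ q then (if hd L < q then 1 - β * x else 1) else 0)) :=
              fun κ _ => elegant_mul_congr fun h => by rw [h]
            rw [sum_congr rfl this]
            simp only [← mul_assoc]
            by_cases h : hd L ≤ q
            · rw [if_pos (by omega), if_pos h, if_pos h, sum_mul, mul_sum]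
              refine sum_congr rfl fun κ _ => ?_
              ring
            · simp [h]
        _ = x ^ (l - q) * ∑ κ ∈ box b (n + 1), ∑ τ ∈ box b n,
            svKernel 0 x κ τ * elegant b β N τ *
              (strip β κ M * if hd κ ≤ q then (if hd κ < q then 1 - β * x else 1) else 0) := by
            rw [sum_comm]
            congr 1
            refine sum_congr rfl fun κ hκ => ?_
            rw [← sum_mul, ← sum_mul, ih κ N hκ hN.2]
        _ = _ := by
            rw [sum_comm]
            congr 1
            refine sum_congr rfl fun τ hτ => ?_
            rw [← sum_svKernel_mul_strip b n q hN.1 x β τ M (mem_box.1 hτ).1 hM.2, mul_sum]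
            refine sum_congr rfl fun κ _ => ?_
            split_ifs <;> ring
    have right : ∑ L ∈ box b n, svKernel 0 x (l :: M) (q :: L) * elegant b β (q :: N) (q :: L) =
        x ^ (l - q) * ∑ τ ∈ box b n, elegant b β N τ *
          if max (hd M) (hd τ) ≤ q then lowerSum b n x β τ M else 0 := by
      calc _ = x ^ (l - q) * ∑ L ∈ box b n, ∑ τ ∈ box b n, elegant b β N τ *
            if max (hd M) (hd N) ≤ q then svKernel 0 x M L * strip β τ L else 0 := by
            rw [mul_sum]
            refine sum_congr rfl fun L hL => ?_
            simp only [elegant, svKernel_zero_cons, true_and, hlenN, hc, max_le_iff]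
            by_cases h1 : hd M ≤ q <;> by_cases h2 : hd N ≤ q <;> simp [h1, h2]
            rw [mul_sum, mul_sum]
            refine sum_congr rfl fun τ _ => ?_
            ring
        _ = _ := by
            rw [sum_comm]
            congr 1
            refine sum_congr rfl fun τ hτ => ?_
            rw [← mul_sum]
            refine elegant_mul_congr fun h => ?_
            rw [h, lowerSum]
            split_ifs <;> simp
    rw [left, right]

/-! ### Iterated kernels and the Cauchy identity for lists -/

/-- Grothendieck functions in `N` variables of partitions with `N` rows. -/
def grothendieckList (b : ℕ) (β : A) (x : ℕ → A) : ℕ → List ℕ → A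
  | 0, L => if L = [] then 1 else 0
  | n + 1, L => ∑ N ∈ box b n, svKernel β (x (n + 1)) L N * grothendieckList b β x n N

/-- Dual Grothendieck functions in `m` variables of partitions with `n` rows. -/
def dualGrothendieckList (b n : ℕ) (β : A) (y : ℕ → A) : ℕ → List ℕ → A
  | 0, L => if L = List.replicate n 0 then 1 else 0
  | m + 1, L => ∑ N ∈ box b n, rppKernel β (y (m + 1)) L N * dualGrothendieckList b n β y m N

/-- The matrix is passed through one kernel per letter, which replaces `β` by `0` in that kernel. -/
theorem sum_elegant_mul_grothendieckList (b n : ℕ) (β : A) (x : ℕ → A) (M : List ℕ)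
    (hM : M ∈ box b n) :
    ∑ L ∈ box b n, elegant b β L M * grothendieckList b β x n L = grothendieckList b 0 x n M := by
  induction n generalizing M with
  | zero =>
    obtain rfl : M = [] := by simpa [box] using hM
    rw [sum_box_zero]
    simp [elegant, grothendieckList]
  | succ n ih =>
    simp only [grothendieckList, mul_sum]
    rw [sum_comm]
    simp only [← mul_assoc, ← sum_mul]
    rw [sum_congr rfl fun N hN => by rw [sum_elegant_mul_svKernel b n β (x (n + 1)) M N hM hN]]
    simp only [sum_mul]
    rw [sum_comm]
    refine sum_congr rfl fun L hL => ?_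
    rw [← ih L hL, mul_sum]
    exact sum_congr rfl fun N _ => by ring

theorem hd_replicate (n : ℕ) : hd (List.replicate n 0) = 0 := by
  cases n <;> simp [List.replicate_succ]

/-- The list `κ` need not be decreasing; the interlacing conditions in `strip` are what exclude a
zero first row above nonzero ones. -/
theorem strip_replicate (x : A) (n : ℕ) (κ : List ℕ) (hκ : κ.length = n) (h : hd κ = 0) :
    strip x κ (List.replicate n 0) = if κ = List.replicate n 0 then 1 else 0 := by
  induction n generalizing κ with
  | zero =>
    obtain rfl : κ = [] := by simpa using hκ
    simp [strip]
  | succ n ih =>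
    obtain _ | ⟨k, κ⟩ := κ
    · simp at hκ
    obtain rfl : k = 0 := h
    by_cases h : hd κ = 0
    · simp [List.replicate_succ, strip, h, ih κ (by simpa using hκ) h]
    · have : κ ≠ List.replicate n 0 := by
        rintro rfl; exact h (hd_replicate n)
      simp [List.replicate_succ, strip, h, this]

/-- The case of no letters in the expansion of dual Grothendieck functions. -/
theorem elegant_replicate (b n : ℕ) (β : A) (L : List ℕ) (hL : L ∈ box b n) :
    elegant b β L (List.replicate n 0) = if L = List.replicate n 0 then 1 else 0 := by
  induction n generalizing L with
  | zero =>
    obtain rfl : L = [] := by simpa [box] using hL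
    simp [elegant]
  | succ n ih =>
    obtain _ | ⟨l, L⟩ := L
    · simp [mem_box] at hL
    rw [cons_mem_box] at hL
    have hlen : L.length = n := (mem_box.1 hL.2).1
    simp only [List.replicate_succ, elegant, List.cons.injEq, hlen]
    by_cases h : l = 0 ∧ hd L ≤ l
    · rw [if_pos h]
      have : ∀ κ ∈ box b n, elegant b β L κ * strip β κ (List.replicate n 0) =
          elegant b β L κ * if κ = List.replicate n 0 then 1 else 0 := fun κ hκ =>
        elegant_mul_congr fun h' => strip_replicate β n κ (mem_box.1 hκ).1 (by omega)
      rw [sum_congr rfl this]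
      simp only [mul_ite, mul_one, mul_zero]
      rw [sum_ite_eq_of_mem' _ _ _ (by simp [mem_box]), ih L hL.2]
      simp [h.1]
    · rw [if_neg h, if_neg]
      rintro ⟨rfl, rfl⟩
      exact h ⟨rfl, (hd_replicate n).le⟩

theorem sum_elegant_mul_dualGrothendieckList (b n m : ℕ) (β : A) (y : ℕ → A) (L : List ℕ)
    (hL : L ∈ box b n) :
    ∑ M ∈ box b n, elegant b β L M * dualGrothendieckList b n 0 y m M =
      dualGrothendieckList b n β y m L := by
  induction m generalizing L with
  | zero =>
    simp only [dualGrothendieckList, mul_ite, mul_one, mul_zero]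
    rw [sum_ite_eq_of_mem' _ _ _ (by simp [mem_box]), elegant_replicate b n β L hL]
  | succ m ih =>
    simp only [dualGrothendieckList, mul_sum, rppKernel_zero]
    rw [sum_comm]
    simp only [← mul_assoc, ← sum_mul]
    rw [sum_congr rfl fun N hN => by rw [← sum_rppKernel_mul_elegant b n β (y (m + 1)) L N hL hN]]
    simp only [sum_mul]
    rw [sum_comm]
    refine sum_congr rfl fun M hM => ?_
    rw [← ih M hM, mul_sum]
    exact sum_congr rfl fun N _ => by ring

/-- The dual functions are expanded in Schur functions, the condition on the first row is moved
across the matrix, and the matrix is then contracted with the Grothendieck functions. -/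
theorem cauchy_list (b n m w : ℕ) (β : A) (x y : ℕ → A) :
    ∑ L ∈ box b n with hd L = w,
        grothendieckList b β x n L * dualGrothendieckList b n β y m L =
      ∑ L ∈ box b n with hd L = w,
        grothendieckList b 0 x n L * dualGrothendieckList b n 0 y m L := by
  calc _ = ∑ L ∈ box b n, ∑ M ∈ box b n, elegant b β L M * ((if hd L = w then 1 else 0) *
        grothendieckList b β x n L * dualGrothendieckList b n 0 y m M) := by
        rw [sum_filter]
        refine sum_congr rfl fun L hL => ?_
        rw [← sum_elegant_mul_dualGrothendieckList b n m β y L hL, mul_sum]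
        split_ifs
        · exact sum_congr rfl fun M _ => by ring
        · simp
    _ = ∑ L ∈ box b n, ∑ M ∈ box b n, elegant b β L M * ((if hd M = w then 1 else 0) *
        grothendieckList b β x n L * dualGrothendieckList b n 0 y m M) :=
        sum_congr rfl fun L _ => sum_congr rfl fun M _ => elegant_mul_congr fun h => by rw [h]
    _ = _ := by
        rw [sum_comm, sum_filter]
        refine sum_congr rfl fun M hM => ?_
        rw [← sum_elegant_mul_grothendieckList b n β x M hM, sum_mul]
        split_ifs
        · exact sum_congr rfl fun M _ => by ring
        · simp

end Kernels

/-! ### Kernels in terms of sequences of row lengths -/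

/-- The list of the first `n` values of `f`. -/
def rowList : (ℕ → ℕ) → ℕ → List ℕ
  | _, 0 => []
  | f, n + 1 => f 0 :: rowList (fun i => f (i + 1)) n

theorem rowList_mem_box {f : ℕ → ℕ} {b : ℕ} (n : ℕ) (h : ∀ i, f i ≤ b) :
    rowList f n ∈ box b n := by
  induction n generalizing f with
  | zero => simp [rowList, box]
  | succ n ih => exact cons_mem_box.2 ⟨h 0, ih fun i => h (i + 1)⟩

theorem rowList_congr {f g : ℕ → ℕ} {n : ℕ} : rowList f n = rowList g n ↔ ∀ i < n, f i = g i := by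
  induction n generalizing f g with
  | zero => simp [rowList]
  | succ n ih =>
    simp only [rowList, List.cons.injEq, ih]
    constructor
    · rintro ⟨h0, h⟩ (_ | i) hi
      · exact h0
      · exact h i (by omega)
    · exact fun h => ⟨h 0 (by omega), fun i hi => h (i + 1) (by omega)⟩

theorem exists_rowList {n : ℕ} {l : List ℕ} (h : l.length = n) :
    ∃ f : ℕ → ℕ, rowList f n = l ∧ ∀ i, n ≤ i → f i = 0 := by
  induction n generalizing l with
  | zero =>
    obtain rfl : l = [] := by simpa using h
    exact ⟨fun _ => 0, rfl, fun _ _ => rfl⟩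
  | succ n ih =>
    obtain _ | ⟨k, l⟩ := l
    · simp at h
    obtain ⟨f, hf, hf0⟩ := ih (l := l) (by simpa using h)
    refine ⟨fun i => Nat.casesOn i k f, by simp [rowList, hf], ?_⟩
    rintro (_ | i) hi
    · omega
    · exact hf0 i (by omega)

theorem hd_rowList {f : ℕ → ℕ} {n : ℕ} (h : f n = 0) : hd (rowList f n) = f 0 := by
  cases n with
  | zero => simp [rowList, h]
  | succ n => rfl

section Kernels

variable {A : Type*} [CommRing A]

/-- The factor `x ^ f n` comes from the extra last row of the outer shape, which the new letter
fills entirely. -/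
theorem svKernel_rowList (β x : A) (f g : ℕ → ℕ) (n : ℕ) :
    svKernel β x (rowList f (n + 1)) (rowList g n) =
      if ∀ i < n, g i ≤ f i ∧ f (i + 1) ≤ g i then
        x ^ f n * ∏ i ∈ range n, (x ^ (f i - g i) * if f (i + 1) < g i then 1 - β * x else 1)
      else 0 := by
  induction n generalizing f g with
  | zero => simp [rowList, svKernel]
  | succ n ih =>
    have := ih (fun i => f (i + 1)) (fun i => g (i + 1))
    rw [show rowList f (n + 1 + 1) = f 0 :: rowList (fun i => f (i + 1)) (n + 1) from rfl,
      show rowList g (n + 1) = g 0 :: rowList (fun i => g (i + 1)) n from rfl, svKernel, this,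
      show hd (rowList (fun i => f (i + 1)) (n + 1)) = f 1 from rfl,
      prod_range_succ']
    simp only [Nat.forall_lt_succ_left, Nat.zero_add]
    by_cases h1 : g 0 ≤ f 0 ∧ f 1 ≤ g 0
    · by_cases h2 : ∀ i < n, g (i + 1) ≤ f (i + 1) ∧ f (i + 1 + 1) ≤ g (i + 1)
      · rw [if_pos h1, if_pos h2, if_pos (And.intro h1 h2)]
        ring
      · rw [if_pos h1, if_neg h2, if_neg (fun h => h2 h.2 : ¬ (_ ∧ _)), mul_zero]
    · rw [if_neg h1, if_neg (fun h => h1 h.1 : ¬ (_ ∧ _))]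

/-- The values at `n` must be `0` to agree with the default `hd [] = 0` used by the kernel in the
last row. -/
theorem rppKernel_rowList (β y : A) (f g : ℕ → ℕ) (n : ℕ) (hf : f n = 0) (hg : g n = 0) :
    rppKernel β y (rowList f n) (rowList g n) =
      if ∀ i < n, g i ≤ f i ∧ f (i + 1) ≤ f i ∧ g (i + 1) ≤ g i then
        ∏ i ∈ range n, (β ^ (f (i + 1) - g i) * y ^ (f i - max (g i) (f (i + 1))))
      else 0 := by
  induction n generalizing f g with
  | zero => simp [rowList, rppKernel]
  | succ n ih =>
    have := ih (fun i => f (i + 1)) (fun i => g (i + 1)) hf hg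
    rw [rowList, rowList, rppKernel, this, hd_rowList (f := fun i => f (i + 1)) hf,
      hd_rowList (f := fun i => g (i + 1)) hg, prod_range_succ']
    by_cases h1 : g 0 ≤ f 0 ∧ f 1 ≤ f 0 ∧ g 1 ≤ g 0
    · by_cases h2 : ∀ i < n, g (i + 1) ≤ f (i + 1) ∧ f (i + 1 + 1) ≤ f (i + 1) ∧
        g (i + 1 + 1) ≤ g (i + 1)
      · rw [if_pos h1, if_pos h2, if_pos]
        · ring
        · rintro (_ | i) hi
          · exact h1
          · exact h2 i (by omega)
      · rw [if_pos h1, if_neg h2, if_neg fun h => h2 fun i hi => h (i + 1) (by omega)]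
        simp
    · rw [if_neg h1, if_neg fun h => h1 (h 0 (by omega))]

end Kernels

/-! ### Young diagrams and their row lengths -/

section Diagrams

/-- The Young diagram with given row lengths. -/
def diagramOfRows (g : ℕ → ℕ) (hg : Antitone g) (n : ℕ) : YoungDiagram where
  cells := (range n ×ˢ range (g 0)).filter fun c => c.2 < g c.1
  isLowerSet := by
    rintro ⟨i, j⟩ ⟨i', j'⟩ ⟨h1, h2⟩ h
    simp only [coe_filter, mem_product, mem_range, Set.mem_ofPred_eq] at h h1 h2 ⊢
    have := hg h1
    omega

theorem rowLen_diagramOfRows {g : ℕ → ℕ} (hg : Antitone g) {n : ℕ} (hn : ∀ i, n ≤ i → g i = 0) :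
    (diagramOfRows g hg n).rowLen = g := by
  have key : ∀ i j, j < (diagramOfRows g hg n).rowLen i ↔ j < g i := by
    intro i j
    rw [← YoungDiagram.mem_iff_lt_rowLen, ← YoungDiagram.mem_cells]
    simp only [diagramOfRows, mem_filter, mem_product, mem_range]
    have h0 := hg (Nat.zero_le i)
    have h1 := hn i
    constructor
    · exact fun h => h.2
    · intro h
      refine ⟨⟨?_, by omega⟩, h⟩
      by_contra h2
      have := h1 (by omega)
      omega
  funext i
  have h1 := key i (g i)
  have h2 := key i ((diagramOfRows g hg n).rowLen i)
  omega

theorem diagram_ext {L M : YoungDiagram} (h : ∀ i, L.rowLen i = M.rowLen i) : L = M := by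
  ext ⟨i, j⟩
  rw [YoungDiagram.mem_cells, YoungDiagram.mem_cells, YoungDiagram.mem_iff_lt_rowLen,
    YoungDiagram.mem_iff_lt_rowLen, h]

variable {L M : YoungDiagram}

theorem mem_of_le {i j i' j' : ℕ} (h : (i', j') ∈ L) (hi : i ≤ i') (hj : j ≤ j') : (i, j) ∈ L :=
  L.up_left_mem hi hj h

theorem prod_cells {A : Type*} [CommMonoid A] {n : ℕ} (hn : ∀ i, n ≤ i → L.rowLen i = 0)
    (F : ℕ × ℕ → A) :
    ∏ c ∈ L.cells, F c = ∏ i ∈ range n, ∏ j ∈ range (L.rowLen i), F (i, j) := by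
  refine prod_finset_product _ _ _ fun c => ?_
  rw [YoungDiagram.mem_cells, YoungDiagram.mem_iff_lt_rowLen, mem_range, mem_range]
  constructor
  · intro h
    refine ⟨?_, h⟩
    by_contra h'
    have := hn c.1 (by omega)
    omega
  · exact fun h => h.2

theorem prod_cells_sdiff {A : Type*} [CommMonoid A] {n : ℕ} (hn : ∀ i, n ≤ i → L.rowLen i = 0)
    (F : ℕ × ℕ → A) :
    ∏ c ∈ L.cells \ M.cells, F c =
      ∏ i ∈ range n, ∏ j ∈ Ico (M.rowLen i) (L.rowLen i), F (i, j) := by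
  refine prod_finset_product _ _ _ fun c => ?_
  rw [mem_sdiff, YoungDiagram.mem_cells, YoungDiagram.mem_iff_lt_rowLen, YoungDiagram.mem_cells,
    YoungDiagram.mem_iff_lt_rowLen, mem_range, mem_Ico]
  constructor
  · intro h
    refine ⟨?_, by omega⟩
    by_contra h'
    have := hn c.1 (by omega)
    omega
  · intro h; omega

end Diagrams

/-! ### Set-valued tableaux: removing the largest letter -/

section SetValued

variable {L M : YoungDiagram} {A : Type*} [CommRing A]

namespace SetValuedTableau

theorem mem_of_mem_entry (P : SetValuedTableau L) {i j a : ℕ} (h : a ∈ P.entry i j) :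
    (i, j) ∈ L := by
  by_contra h'
  simp [P.empty_outside i j h'] at h

theorem le_of_mem_entry (P : SetValuedTableau L) {i j i' j' a a' : ℕ} (h : a ∈ P.entry i j)
    (h' : a' ∈ P.entry i' j') (hi : i ≤ i') (hj : j ≤ j') (hne : (i, j) ≠ (i', j')) : a ≤ a' := by
  have hc' := P.mem_of_mem_entry h'
  have hm : (i, j') ∈ L := mem_of_le hc' hi le_rfl
  obtain rfl | hi := hi.eq_or_lt
  · exact P.row_weak i j j' (hj.lt_of_ne (by rintro rfl; exact hne rfl)) (P.mem_of_mem_entry h)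
      hc' a h a' h'
  obtain rfl | hj := hj.eq_or_lt
  · exact (P.col_strict i i' j hi (P.mem_of_mem_entry h) hc' a h a' h').le
  · obtain ⟨c, hc⟩ := P.nonempty i j' hm
    exact (P.row_weak i j j' hj (P.mem_of_mem_entry h) hm a h c hc).trans
      (P.col_strict i i' j' hi hm hc' c hc a' h').le

/-- Entries are positive and strictly increase down a column. Consequently `N` letters allow at most
`N` rows. -/
theorem lt_of_mem_entry (P : SetValuedTableau L) {i j a : ℕ} (h : a ∈ P.entry i j) : i < a := by
  induction i generalizing a with
  | zero => exact P.pos 0 j a h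
  | succ i ih =>
    have hm := P.mem_of_mem_entry h
    have hm' : (i, j) ∈ L := mem_of_le hm (by omega) le_rfl
    obtain ⟨c, hc⟩ := P.nonempty i j hm'
    have := P.col_strict i (i + 1) j (by omega) hm' hm c hc a h
    have := ih hc
    omega

/-- All entries are at most `N`. -/
def Bounded (P : SetValuedTableau L) (N : ℕ) : Prop :=
  ∀ i j a, a ∈ P.entry i j → a ≤ N

theorem finite_bounded (L : YoungDiagram) (N : ℕ) :
    {P : SetValuedTableau L | P.Bounded N}.Finite := by
  let F : SetValuedTableau L → (L.cells → Finset ℕ) := fun P c => P.entry c.1.1 c.1.2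
  refine Set.Finite.of_injOn (f := F) (t := Set.pi Set.univ fun _ => ↑(range (N + 1)).powerset)
    ?_ ?_ (Set.Finite.pi fun _ => (range (N + 1)).powerset.finite_toSet)
  · intro P hP c _
    simp only [coe_powerset, Set.mem_preimage, Set.mem_powerset_iff, coe_subset, F]
    intro a ha
    exact mem_range.2 (Nat.lt_succ_of_le (hP _ _ _ ha))
  · intro P _ Q _ h
    ext1
    funext i j
    by_cases hm : (i, j) ∈ L
    · exact congrFun h ⟨(i, j), hm⟩
    · rw [P.empty_outside _ _ hm, Q.empty_outside _ _ hm]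

/-- The tableaux with entries at most `N`. -/
def bounded (L : YoungDiagram) (N : ℕ) : Finset (SetValuedTableau L) :=
  (finite_bounded L N).toFinset

@[simp] theorem mem_bounded {P : SetValuedTableau L} {N : ℕ} : P ∈ bounded L N ↔ P.Bounded N := by
  simp [bounded]

/-- The boxes that hold an entry at most `N`. -/
def cut (P : SetValuedTableau L) (N : ℕ) : YoungDiagram where
  cells := L.cells.filter fun c => ∃ a ∈ P.entry c.1 c.2, a ≤ N
  isLowerSet := by
    rintro ⟨i, j⟩ ⟨i', j'⟩ ⟨h1, h2⟩ h
    simp only [coe_filter, Set.mem_ofPred_eq, YoungDiagram.mem_cells] at h h1 h2 ⊢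
    obtain ⟨hm, a, ha, haN⟩ := h
    have hm' : (i', j') ∈ L := mem_of_le hm h1 h2
    refine ⟨hm', ?_⟩
    by_cases hne : (i', j') = (i, j)
    · simp only [Prod.mk.injEq] at hne
      obtain ⟨rfl, rfl⟩ := hne
      exact ⟨a, ha, haN⟩
    · obtain ⟨c, hc⟩ := P.nonempty i' j' hm'
      exact ⟨c, hc, (P.le_of_mem_entry hc ha h1 h2 hne).trans haN⟩

theorem mem_cut {P : SetValuedTableau L} {N i j : ℕ} :
    (i, j) ∈ P.cut N ↔ ∃ a ∈ P.entry i j, a ≤ N := by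
  rw [← YoungDiagram.mem_cells]
  simp only [cut, mem_filter, YoungDiagram.mem_cells, and_iff_right_iff_imp]
  rintro ⟨a, ha, -⟩
  exact P.mem_of_mem_entry ha

theorem powMonomial_content (P : SetValuedTableau L) (z : ℕ → A) :
    powMonomial z P.content = ∏ c ∈ L.cells, ∏ k ∈ P.entry c.1 c.2, z k := by
  rw [powMonomial, content, Finsupp.onFinset_prod _ (by simp)]
  simp only [← prod_const]
  refine prod_comm' fun k c => ?_
  simp only [mem_biUnion, mem_filter]
  constructor
  · exact fun h => ⟨h.2.2, h.2.1⟩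
  · exact fun h => ⟨⟨c, h.2, h.1⟩, h.2, h.1⟩

/-- The contribution to the Grothendieck function. -/
def weight (b : A) (z : ℕ → A) (P : SetValuedTableau L) : A :=
  (-b) ^ P.excess * powMonomial z P.content

theorem weight_eq_prod (b : A) (z : ℕ → A) (P : SetValuedTableau L) :
    P.weight b z = ∏ c ∈ L.cells, ((-b) ^ ((P.entry c.1 c.2).card - 1) *
      ∏ k ∈ P.entry c.1 c.2, z k) := by
  rw [weight, powMonomial_content, excess, ← prod_pow_eq_pow_sum, prod_mul_distrib]

theorem rowLen_eq_zero_of_bounded {P : SetValuedTableau L} {N i : ℕ} (hP : P.Bounded N)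
    (h : N ≤ i) : L.rowLen i = 0 := by
  by_contra h0
  obtain ⟨a, ha⟩ := P.nonempty i 0 (YoungDiagram.mem_iff_lt_rowLen.2 (by omega))
  have := P.lt_of_mem_entry ha
  have := hP _ _ _ ha
  omega

theorem rowLen_cut_eq_zero (P : SetValuedTableau L) {N i : ℕ} (h : N ≤ i) :
    (P.cut N).rowLen i = 0 := by
  by_contra h0
  obtain ⟨a, ha, haN⟩ := mem_cut.1
    ((YoungDiagram.mem_iff_lt_rowLen (μ := P.cut N) (i := i) (j := 0)).2 (by omega))
  have := P.lt_of_mem_entry ha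
  omega

theorem rowLen_cut_le (P : SetValuedTableau L) (N i : ℕ) : (P.cut N).rowLen i ≤ L.rowLen i := by
  by_contra! h
  obtain ⟨a, ha, -⟩ := mem_cut.1 (YoungDiagram.mem_iff_lt_rowLen.2 h)
  have := YoungDiagram.mem_iff_lt_rowLen.1 (P.mem_of_mem_entry ha)
  omega

/-- A box with a box below it contains only entries smaller than `N + 1`, so it survives the cut. -/
theorem rowLen_le_rowLen_cut {P : SetValuedTableau L} {N : ℕ} (hP : P.Bounded (N + 1)) (i : ℕ) :
    L.rowLen (i + 1) ≤ (P.cut N).rowLen i := by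
  by_contra! h
  have hm := YoungDiagram.mem_iff_lt_rowLen.2 h
  have hm' : (i, (P.cut N).rowLen i) ∈ L := mem_of_le hm (by omega) le_rfl
  obtain ⟨a, ha⟩ := P.nonempty _ _ hm
  obtain ⟨c, hc⟩ := P.nonempty _ _ hm'
  have h1 := P.col_strict _ _ _ (Nat.lt_succ_self i) hm' hm c hc a ha
  have h2 := hP _ _ _ ha
  have : (i, (P.cut N).rowLen i) ∈ P.cut N := mem_cut.2 ⟨c, hc, by omega⟩
  simp [YoungDiagram.mem_iff_lt_rowLen] at this

/-- The entries at most `N`. -/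
def restrict (P : SetValuedTableau L) (N : ℕ) (M : YoungDiagram) (h : P.cut N = M) :
    SetValuedTableau M where
  entry i j := (P.entry i j).filter (· ≤ N)
  nonempty i j hm := by
    subst h
    obtain ⟨a, ha, haN⟩ := mem_cut.1 hm
    exact ⟨a, mem_filter.2 ⟨ha, haN⟩⟩
  pos i j a ha := P.pos i j a (mem_filter.1 ha).1
  col_strict i i' j hi _ _ a ha b hb :=
    P.col_strict i i' j hi (P.mem_of_mem_entry (mem_filter.1 ha).1)
      (P.mem_of_mem_entry (mem_filter.1 hb).1) a (mem_filter.1 ha).1 b (mem_filter.1 hb).1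
  row_weak i j j' hj _ _ a ha b hb :=
    P.row_weak i j j' hj (P.mem_of_mem_entry (mem_filter.1 ha).1)
      (P.mem_of_mem_entry (mem_filter.1 hb).1) a (mem_filter.1 ha).1 b (mem_filter.1 hb).1
  empty_outside i j hm := by
    subst h
    refine filter_eq_empty_iff.2 fun a ha haN => hm (mem_cut.2 ⟨a, ha, haN⟩)

/-- The boxes that receive the new letter, for a set `C` of rows whose last box receives it. -/
def NewBox (L M : YoungDiagram) (C : Finset ℕ) (i j : ℕ) : Prop :=
  (M.rowLen i ≤ j ∧ j < L.rowLen i) ∨ (i ∈ C ∧ j + 1 = M.rowLen i)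

open Classical in
/-- The entries of the tableau extended by the letter `N + 1`. -/
def extendEntry (P : SetValuedTableau M) (L : YoungDiagram) (N : ℕ) (C : Finset ℕ) (i j : ℕ) :
    Finset ℕ :=
  P.entry i j ∪ if NewBox L M C i j then {N + 1} else ∅

theorem mem_extendEntry {P : SetValuedTableau M} {N : ℕ} {C : Finset ℕ} {i j a : ℕ} :
    a ∈ P.extendEntry L N C i j ↔ a ∈ P.entry i j ∨ a = N + 1 ∧ NewBox L M C i j := by
  rw [extendEntry, mem_union]
  split_ifs with h <;> simp [h]

/-- The tableau extended by the letter `N + 1`. -/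
def extend (P : SetValuedTableau M) (N : ℕ) (hP : P.Bounded N) (C : Finset ℕ)
    (hML : ∀ i, M.rowLen i ≤ L.rowLen i) (hLM : ∀ i, L.rowLen (i + 1) ≤ M.rowLen i)
    (hC : ∀ i ∈ C, L.rowLen (i + 1) < M.rowLen i) : SetValuedTableau L where
  entry := P.extendEntry L N C
  nonempty i j hm := by
    by_cases h : (i, j) ∈ M
    · obtain ⟨a, ha⟩ := P.nonempty i j h
      exact ⟨a, mem_extendEntry.2 (Or.inl ha)⟩
    · rw [YoungDiagram.mem_iff_lt_rowLen] at hm h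
      exact ⟨N + 1, mem_extendEntry.2 (Or.inr ⟨rfl, Or.inl ⟨by omega, hm⟩⟩)⟩
  pos i j a ha := by
    obtain h | h := mem_extendEntry.1 ha
    · exact P.pos i j a h
    · omega
  col_strict i i' j hi hm hm' a ha b hb := by
    -- A box with a box of `L` below it does not receive the new letter: `hLM` excludes the boxes
    -- outside `M`, and `hC` the last boxes of the chosen rows.
    have hnew : ¬ NewBox L M C i j := by
      have h1 := YoungDiagram.mem_iff_lt_rowLen.1 hm'
      have h2 := L.rowLen_anti (i + 1) i' hi
      have h3 := hLM i
      rintro (h | ⟨h, h4⟩)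
      · omega
      · have := hC i h
        omega
    obtain ha | ha := mem_extendEntry.1 ha
    · obtain hb | hb := mem_extendEntry.1 hb
      · exact P.col_strict i i' j hi (P.mem_of_mem_entry ha) (P.mem_of_mem_entry hb) a ha b hb
      · have := hP _ _ _ ha
        omega
    · exact absurd ha.2 hnew
  row_weak i j j' hj hm hm' a ha b hb := by
    obtain ha | ha := mem_extendEntry.1 ha
    · obtain hb | hb := mem_extendEntry.1 hb
      · exact P.row_weak i j j' hj (P.mem_of_mem_entry ha) (P.mem_of_mem_entry hb) a ha b hb
      · have := hP _ _ _ ha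
        omega
    · obtain hb | hb := mem_extendEntry.1 hb
      · have h1 := YoungDiagram.mem_iff_lt_rowLen.1 (P.mem_of_mem_entry hb)
        obtain h | h := ha.2 <;> omega
      · omega
  empty_outside i j hm := by
    rw [eq_empty_iff_forall_notMem]
    intro a ha
    rw [YoungDiagram.mem_iff_lt_rowLen] at hm
    have h0 := hML i
    obtain ha | ha := mem_extendEntry.1 ha
    · have h1 := YoungDiagram.mem_iff_lt_rowLen.1 (P.mem_of_mem_entry ha)
      omega
    · obtain h | h := ha.2 <;> omega

section Extend

variable {P : SetValuedTableau M} {N : ℕ} {hP : P.Bounded N} {C : Finset ℕ}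
  {hML : ∀ i, M.rowLen i ≤ L.rowLen i} {hLM : ∀ i, L.rowLen (i + 1) ≤ M.rowLen i}
  {hC : ∀ i ∈ C, L.rowLen (i + 1) < M.rowLen i}

theorem bounded_extend : (P.extend N hP C hML hLM hC).Bounded (N + 1) := by
  intro i j a ha
  obtain ha | ha := mem_extendEntry.1 ha
  · exact (hP _ _ _ ha).trans (Nat.le_succ N)
  · exact ha.1.le

theorem cut_extend : (P.extend N hP C hML hLM hC).cut N = M := by
  ext ⟨i, j⟩
  rw [YoungDiagram.mem_cells, YoungDiagram.mem_cells, mem_cut]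
  constructor
  · rintro ⟨a, ha, haN⟩
    obtain ha | ha := mem_extendEntry.1 ha
    · exact P.mem_of_mem_entry ha
    · omega
  · intro h
    obtain ⟨a, ha⟩ := P.nonempty i j h
    exact ⟨a, mem_extendEntry.2 (Or.inl ha), hP _ _ _ ha⟩

theorem restrict_extend : (P.extend N hP C hML hLM hC).restrict N M cut_extend = P := by
  ext _ _ a
  simp only [restrict, extend, mem_filter, mem_extendEntry]
  constructor
  · rintro ⟨ha | ha, haN⟩
    · exact ha
    · omega
  · exact fun ha => ⟨Or.inl ha, hP _ _ _ ha⟩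

/-- A box outside `M` holds the new letter alone and contributes `z (n + 1)`; adding that letter to
an occupied box raises the excess by one and contributes `-(b * z (n + 1))`. -/
theorem weight_extend {n : ℕ} {hP : P.Bounded n} (hCn : C ⊆ range n)
    (hM : ∀ i, n ≤ i → M.rowLen i = 0) (b : A) (z : ℕ → A) :
    (P.extend n hP C hML hLM hC).weight b z =
      (∏ _i ∈ C, (-(b * z (n + 1)))) * (z (n + 1) ^ L.rowLen n *
        ∏ i ∈ range n, z (n + 1) ^ (L.rowLen i - M.rowLen i)) * P.weight b z := by
  have hsub : M.cells ⊆ L.cells := by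
    rintro ⟨i, j⟩
    rw [YoungDiagram.mem_cells, YoungDiagram.mem_cells, YoungDiagram.mem_iff_lt_rowLen,
      YoungDiagram.mem_iff_lt_rowLen]
    exact fun h => h.trans_le (hML i)
  have hL : ∀ i, n + 1 ≤ i → L.rowLen i = 0 := by
    rintro (_ | i) _
    · omega
    · have h1 := hM i (by omega)
      have h2 := hLM i
      omega
  have hnew : ∀ c ∈ L.cells \ M.cells, (-b) ^ (((P.extend n hP C hML hLM hC).entry c.1 c.2).card - 1)
      * ∏ k ∈ (P.extend n hP C hML hLM hC).entry c.1 c.2, z k = z (n + 1) := by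
    rintro ⟨i, j⟩ hc
    rw [mem_sdiff, YoungDiagram.mem_cells, YoungDiagram.mem_cells] at hc
    have hnew : NewBox L M C i j := by
      rw [YoungDiagram.mem_iff_lt_rowLen, YoungDiagram.mem_iff_lt_rowLen] at hc
      exact Or.inl ⟨by omega, hc.1⟩
    simp [extend, extendEntry, hnew, P.empty_outside i j hc.2]
  have hold : ∀ c ∈ M.cells, (-b) ^ (((P.extend n hP C hML hLM hC).entry c.1 c.2).card - 1)
      * ∏ k ∈ (P.extend n hP C hML hLM hC).entry c.1 c.2, z k =
      (if c.1 ∈ C ∧ c.2 + 1 = M.rowLen c.1 then -(b * z (n + 1)) else 1) *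
        ((-b) ^ ((P.entry c.1 c.2).card - 1) * ∏ k ∈ P.entry c.1 c.2, z k) := by
    rintro ⟨i, j⟩ hc
    rw [YoungDiagram.mem_cells] at hc
    have hc' := YoungDiagram.mem_iff_lt_rowLen.1 hc
    simp only [extend, extendEntry]
    by_cases h : i ∈ C ∧ j + 1 = M.rowLen i
    · have hnew : NewBox L M C i j := Or.inr h
      have hn : n + 1 ∉ P.entry i j := fun h' => by
        have := hP _ _ _ h'
        omega
      have hpos := (P.nonempty i j hc).card_pos
      rw [if_pos hnew, if_pos h, card_union_of_disjoint (by simpa using hn),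
        prod_union (by simpa using hn), card_singleton, prod_singleton,
        show (P.entry i j).card + 1 - 1 = ((P.entry i j).card - 1) + 1 by omega]
      ring
    · have hnew : ¬ NewBox L M C i j := by
        rintro (h' | h')
        · omega
        · exact h h'
      rw [if_neg hnew, if_neg h, union_empty, one_mul]
  rw [weight_eq_prod, ← prod_sdiff hsub, prod_congr rfl hnew, prod_congr rfl hold,
    prod_mul_distrib, ← weight_eq_prod, prod_cells_sdiff hL, prod_range_succ, prod_cells hM]
  have hcorner : ∀ i ∈ range n, (∏ j ∈ range (M.rowLen i),
      if (i, j).1 ∈ C ∧ (i, j).2 + 1 = M.rowLen (i, j).1 then -(b * z (n + 1)) else 1) =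
      if i ∈ C then -(b * z (n + 1)) else 1 := by
    intro i _
    by_cases hi : i ∈ C
    · have := hC i hi
      rw [prod_eq_single (M.rowLen i - 1)]
      · rw [if_pos ⟨hi, by simp only; omega⟩, if_pos hi]
      · intro j hj hne
        rw [if_neg]
        rintro ⟨-, h⟩
        simp only at h
        omega
      · intro h
        simp at h
        omega
    · simp [hi]
  rw [prod_congr rfl hcorner, prod_ite_mem, inter_eq_right.2 hCn]
  simp only [prod_const, Nat.card_Ico, hM n le_rfl, Nat.sub_zero]
  ring

end Extend

theorem extend_restrict {P : SetValuedTableau L} {n : ℕ} (hP : P.Bounded (n + 1))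
    (h : P.cut n = M) (C : Finset ℕ) (hP' : (P.restrict n M h).Bounded n)
    (hML : ∀ i, M.rowLen i ≤ L.rowLen i) (hLM : ∀ i, L.rowLen (i + 1) ≤ M.rowLen i)
    (hC : ∀ i ∈ C, L.rowLen (i + 1) < M.rowLen i)
    (hCP : ∀ i, i ∈ C ↔ i < n ∧ L.rowLen (i + 1) < M.rowLen i ∧
      n + 1 ∈ P.entry i (M.rowLen i - 1)) :
    (P.restrict n M h).extend n hP' C hML hLM hC = P := by
  subst h
  ext i j a
  simp only [extend, mem_extendEntry, restrict, mem_filter]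
  constructor
  · rintro (ha | ⟨rfl, h | ⟨hi, h⟩⟩)
    · exact ha.1
    · have hm : (i, j) ∈ L := YoungDiagram.mem_iff_lt_rowLen.2 h.2
      have hm' : (i, j) ∉ P.cut n := fun h' => by
        have := YoungDiagram.mem_iff_lt_rowLen.1 h'
        omega
      obtain ⟨a, ha⟩ := P.nonempty i j hm
      have h1 := hP _ _ _ ha
      have h2 : ¬ a ≤ n := fun h' => hm' (mem_cut.2 ⟨a, ha, h'⟩)
      obtain rfl : a = n + 1 := by omega
      exact ha
    · have := ((hCP i).1 hi).2.2
      rwa [← h, Nat.add_sub_cancel] at this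
  · intro ha
    have h1 := hP _ _ _ ha
    by_cases h2 : a ≤ n
    · exact Or.inl ⟨ha, h2⟩
    obtain rfl : a = n + 1 := by omega
    refine Or.inr ⟨rfl, ?_⟩
    have hm := YoungDiagram.mem_iff_lt_rowLen.1 (P.mem_of_mem_entry ha)
    by_cases hj : (P.cut n).rowLen i ≤ j
    · exact Or.inl ⟨hj, hm⟩
    -- If the right neighbour survived the cut, it would hold an entry at most `n`, to the right of
    -- an entry `n + 1`.
    have hlast : j + 1 = (P.cut n).rowLen i := by
      by_contra hne
      have : (i, j + 1) ∈ P.cut n := YoungDiagram.mem_iff_lt_rowLen.2 (by omega)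
      obtain ⟨c, hc, hcn⟩ := mem_cut.1 this
      have := P.le_of_mem_entry ha hc le_rfl (Nat.le_succ j) (by simp)
      omega
    refine Or.inr ⟨(hCP i).2 ⟨?_, ?_, ?_⟩, hlast⟩
    · by_contra hi
      have := P.rowLen_cut_eq_zero (N := n) (i := i) (by omega)
      omega
    · by_contra hlt
      have hm' : (i + 1, j) ∈ L := YoungDiagram.mem_iff_lt_rowLen.2 (by omega)
      obtain ⟨c, hc⟩ := P.nonempty _ _ hm'
      have h3 := P.col_strict i (i + 1) j (Nat.lt_succ_self i) (P.mem_of_mem_entry ha) hm' _ ha c hc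
      have h4 := hP _ _ _ hc
      omega
    · rwa [← hlast, Nat.add_sub_cancel]

theorem bounded_restrict {P : SetValuedTableau L} {n : ℕ} (h : P.cut n = M) :
    (P.restrict n M h).Bounded n :=
  fun _ _ _ ha => (mem_filter.1 ha).2

-- A tableau with the given cut amounts to a tableau on `M` and a set of rows whose last box in `M`
-- also holds the new letter. A row is eligible exactly if no box of `L` lies below that box, and
-- the sum over sets of eligible rows gives one factor `1 - b * z (n + 1)` for each.
open Classical in
theorem sum_weight_cut (n : ℕ) (hML : ∀ i, M.rowLen i ≤ L.rowLen i)
    (hLM : ∀ i, L.rowLen (i + 1) ≤ M.rowLen i) (hM : ∀ i, n ≤ i → M.rowLen i = 0)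
    (b : A) (z : ℕ → A) :
    ∑ P ∈ bounded L (n + 1) with P.cut n = M, P.weight b z =
      (z (n + 1) ^ L.rowLen n * ∏ i ∈ range n, (z (n + 1) ^ (L.rowLen i - M.rowLen i) *
        if L.rowLen (i + 1) < M.rowLen i then 1 - b * z (n + 1) else 1)) *
      ∑ P ∈ bounded M n, P.weight b z := by
  set free := (range n).filter fun i => L.rowLen (i + 1) < M.rowLen i with hfree
  have key : ∑ p ∈ bounded M n ×ˢ free.powerset,
      (∏ i ∈ p.2, (-(b * z (n + 1)))) * (z (n + 1) ^ L.rowLen n *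
        ∏ i ∈ range n, z (n + 1) ^ (L.rowLen i - M.rowLen i)) * p.1.weight b z =
      ∑ P ∈ bounded L (n + 1) with P.cut n = M, P.weight b z := by
    have aux : ∀ p ∈ bounded M n ×ˢ free.powerset, p.1.Bounded n ∧ p.2 ⊆ range n ∧
        ∀ i ∈ p.2, L.rowLen (i + 1) < M.rowLen i := by
      intro p hp
      rw [mem_product, mem_bounded, mem_powerset] at hp
      exact ⟨hp.1, fun i hi => (mem_filter.1 (hp.2 hi)).1, fun i hi => (mem_filter.1 (hp.2 hi)).2⟩
    refine sum_bij' (fun p hp => p.1.extend n (aux p hp).1 p.2 hML hLM (aux p hp).2.2)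
      (fun P hP => (P.restrict n M (mem_filter.1 hP).2,
        free.filter fun i => n + 1 ∈ P.entry i (M.rowLen i - 1))) ?_ ?_ ?_ ?_ ?_
    · intro p hp
      rw [mem_filter, mem_bounded]
      exact ⟨bounded_extend, cut_extend⟩
    · intro P hP
      rw [mem_product, mem_bounded, mem_powerset]
      exact ⟨bounded_restrict (mem_filter.1 hP).2, filter_subset _ _⟩
    · intro p hp
      refine Prod.ext restrict_extend ?_
      ext i
      simp only [mem_filter, hfree, mem_range, extend, mem_extendEntry]
      constructor
      · rintro ⟨⟨hi, h⟩, h' | ⟨-, h' | h'⟩⟩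
        · have := (aux p hp).1 _ _ _ h'
          omega
        · omega
        · exact h'.1
      · intro hi
        have h1 := (aux p hp).2.2 i hi
        exact ⟨⟨mem_range.1 ((aux p hp).2.1 hi), h1⟩, Or.inr ⟨trivial, Or.inr ⟨hi, by omega⟩⟩⟩
    · intro P hP
      refine extend_restrict (mem_bounded.1 (mem_filter.1 hP).1) (mem_filter.1 hP).2 _ _ _ _ _ fun i => ?_
      simp only [mem_filter, hfree, mem_range, and_assoc]
    · intro p hp
      rw [weight_extend (aux p hp).2.1 hM]
  rw [← key, sum_product_right]
  simp only [← mul_sum, ← sum_mul]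
  rw [← prod_one_add, prod_mul_distrib, hfree, prod_filter]
  simp only [← sub_eq_add_neg]
  ring

theorem sum_weight_bounded (b : A) (z : ℕ → A) (w n : ℕ) (L : YoungDiagram)
    (hw : L.rowLen 0 ≤ w) (hL : ∀ i, n ≤ i → L.rowLen i = 0) :
    ∑ P ∈ bounded L n, P.weight b z = grothendieckList w b z n (rowList L.rowLen n) := by
  classical
  induction n generalizing L with
  | zero =>
    have hcells : L.cells = ∅ := by
      rw [eq_empty_iff_forall_notMem]
      rintro ⟨i, j⟩ h
      rw [YoungDiagram.mem_cells, YoungDiagram.mem_iff_lt_rowLen, hL i (Nat.zero_le i)] at h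
      omega
    have hnot : ∀ i j, (i, j) ∉ L := fun i j h => by
      rw [← YoungDiagram.mem_cells, hcells] at h
      simp at h
    let P₀ : SetValuedTableau L :=
      { entry := fun _ _ => ∅
        nonempty := fun i j h => absurd h (hnot i j)
        pos := by simp
        col_strict := by simp
        row_weak := by simp
        empty_outside := fun _ _ _ => rfl }
    have : bounded L 0 = {P₀} := by
      ext P
      rw [mem_bounded, mem_singleton]
      constructor
      · intro _
        ext1
        funext i j
        exact P.empty_outside i j (hnot i j)
      · rintro rfl i j a ha
        simp [P₀] at ha
    rw [this, sum_singleton, weight_eq_prod, hcells]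
    simp [grothendieckList, rowList]
  | succ n ih =>
    rw [← sum_fiberwise_of_maps_to (t := box w n) (g := fun P => rowList (P.cut n).rowLen n)
      fun P _ => rowList_mem_box n fun i =>
        (P.rowLen_cut_le n i).trans ((L.rowLen_anti 0 i (Nat.zero_le i)).trans hw)]
    rw [grothendieckList]
    refine sum_congr rfl fun l hl => ?_
    obtain ⟨g, rfl, hg⟩ := exists_rowList (mem_box.1 hl).1
    rw [svKernel_rowList]
    split_ifs with hi
    · have hanti : Antitone g := by
        refine antitone_nat_of_succ_le fun i => ?_
        by_cases h : i + 1 < n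
        · exact ((hi (i + 1) h).1).trans (hi i (by omega)).2
        · rw [hg (i + 1) (by omega)]
          exact Nat.zero_le _
      have hrow := rowLen_diagramOfRows hanti hg
      set M := diagramOfRows g hanti n
      have hML : ∀ i, M.rowLen i ≤ L.rowLen i := by
        intro i
        rw [hrow]
        by_cases h : i < n
        · exact (hi i h).1
        · rw [hg i (by omega)]
          exact Nat.zero_le _
      have hLM : ∀ i, L.rowLen (i + 1) ≤ M.rowLen i := by
        intro i
        rw [hrow]
        by_cases h : i < n
        · exact (hi i h).2
        · rw [hL (i + 1) (by omega)]
          exact Nat.zero_le _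
      have hcut : ∀ P : SetValuedTableau L, rowList (P.cut n).rowLen n = rowList g n ↔
          P.cut n = M := by
        intro P
        rw [rowList_congr, ← hrow]
        constructor
        · intro h
          refine diagram_ext fun i => ?_
          by_cases hn : i < n
          · exact h i hn
          · rw [P.rowLen_cut_eq_zero (by omega), hrow, hg i (by omega)]
        · intro h i _
          rw [h]
      have hM0 : ∀ i, n ≤ i → M.rowLen i = 0 := by rwa [hrow]
      have hMw : M.rowLen 0 ≤ w := (hML 0).trans hw
      rw [filter_congr fun P _ => hcut P, sum_weight_cut n hML hLM hM0, ih M hMw hM0, hrow]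
    · rw [zero_mul]
      -- A list that fails the interlacing conditions is not the shape of any cut, so its fibre is
      -- empty.
      refine sum_eq_zero fun P hP => ?_
      rw [mem_filter, mem_bounded, rowList_congr] at hP
      refine absurd (fun i h => ?_) hi
      rw [← hP.2 i h]
      exact ⟨P.rowLen_cut_le n i, rowLen_le_rowLen_cut hP.1 i⟩

end SetValuedTableau
end SetValued

/-! ### Reverse plane partitions: removing the largest letter -/

section ReversePlane

variable {L M : YoungDiagram} {A : Type*} [CommRing A]
namespace ReversePlanePartition

theorem le_of_le (Q : ReversePlanePartition L) {i j i' j' : ℕ} (h : (i', j') ∈ L)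
    (hi : i ≤ i') (hj : j ≤ j') : Q.entry i j ≤ Q.entry i' j' := by
  have hm : (i, j') ∈ L := mem_of_le h hi le_rfl
  have h1 : Q.entry i j ≤ Q.entry i j' := by
    obtain rfl | hj := hj.eq_or_lt
    · exact le_rfl
    · exact Q.row_weak i j j' hj (mem_of_le hm le_rfl hj.le) hm
  refine h1.trans ?_
  obtain rfl | hi := hi.eq_or_lt
  · exact le_rfl
  · exact Q.col_weak i i' j' hi hm h

/-- All entries are at most `N`. -/
def Bounded (Q : ReversePlanePartition L) (N : ℕ) : Prop :=
  ∀ i j, Q.entry i j ≤ N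

theorem finite_bounded (L : YoungDiagram) (N : ℕ) :
    {Q : ReversePlanePartition L | Q.Bounded N}.Finite := by
  let F : ReversePlanePartition L → (L.cells → ℕ) := fun Q c => Q.entry c.1.1 c.1.2
  refine Set.Finite.of_injOn (f := F) (t := Set.pi Set.univ fun _ => ↑(range (N + 1)))
    ?_ ?_ (Set.Finite.pi fun _ => (range (N + 1)).finite_toSet)
  · intro Q hQ c _
    exact mem_coe.2 (mem_range.2 (Nat.lt_succ_of_le (hQ _ _)))
  · intro P _ Q _ h
    ext i j
    by_cases hm : (i, j) ∈ L
    · exact congrFun h ⟨(i, j), hm⟩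
    · rw [P.zero_outside _ _ hm, Q.zero_outside _ _ hm]

/-- The reverse plane partitions with entries at most `N`. -/
def bounded (L : YoungDiagram) (N : ℕ) : Finset (ReversePlanePartition L) :=
  (finite_bounded L N).toFinset

@[simp] theorem mem_bounded {Q : ReversePlanePartition L} {N : ℕ} :
    Q ∈ bounded L N ↔ Q.Bounded N := by
  simp [bounded]

/-- The boxes whose entry is at most `N`. -/
def cut (Q : ReversePlanePartition L) (N : ℕ) : YoungDiagram where
  cells := L.cells.filter fun c => Q.entry c.1 c.2 ≤ N
  isLowerSet := by
    rintro ⟨i, j⟩ ⟨i', j'⟩ ⟨h1, h2⟩ h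
    simp only [coe_filter, Set.mem_ofPred_eq, YoungDiagram.mem_cells] at h h1 h2 ⊢
    exact ⟨mem_of_le h.1 h1 h2, (Q.le_of_le h.1 h1 h2).trans h.2⟩

theorem mem_cut {Q : ReversePlanePartition L} {N i j : ℕ} :
    (i, j) ∈ Q.cut N ↔ (i, j) ∈ L ∧ Q.entry i j ≤ N := by
  rw [← YoungDiagram.mem_cells]
  simp only [cut, mem_filter, YoungDiagram.mem_cells]

theorem rowLen_cut_le (Q : ReversePlanePartition L) (N i : ℕ) :
    (Q.cut N).rowLen i ≤ L.rowLen i := by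
  by_contra! h
  have := YoungDiagram.mem_iff_lt_rowLen.1
    (mem_cut.1 (YoungDiagram.mem_iff_lt_rowLen.2 h)).1
  omega

/-- The lower neighbour is a box with the same entry. -/
def Repeats (Q : ReversePlanePartition L) (c : ℕ × ℕ) : Prop :=
  (c.1 + 1, c.2) ∈ L ∧ Q.entry c.1 c.2 = Q.entry (c.1 + 1) c.2

instance (Q : ReversePlanePartition L) : DecidablePred Q.Repeats :=
  fun _ => inferInstanceAs (Decidable (_ ∧ _))

/-- In each column containing `k`, the boxes with entry `k` are consecutive, and only the lowest one
is not a repeat. Counting columns thus becomes counting boxes, and the weight becomes a product over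
boxes. -/
theorem card_columns (Q : ReversePlanePartition L) (k : ℕ) :
    ((L.cells.filter fun c => Q.entry c.1 c.2 = k).image Prod.snd).card =
      ((L.cells.filter fun c => ¬ Q.Repeats c).filter fun c => Q.entry c.1 c.2 = k).card := by
  have himage : (L.cells.filter fun c => Q.entry c.1 c.2 = k).image Prod.snd =
      ((L.cells.filter fun c => ¬ Q.Repeats c).filter fun c => Q.entry c.1 c.2 = k).image
        Prod.snd := by
    refine Subset.antisymm ?_ (image_subset_image fun c hc => ?_)
    · intro j hj
      obtain ⟨c, hc, rfl⟩ := mem_image.1 hj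
      have hne : ((L.cells.filter fun c => Q.entry c.1 c.2 = k).filter
          fun d => d.2 = c.2).Nonempty := ⟨c, mem_filter.2 ⟨hc, rfl⟩⟩
      obtain ⟨d, hd, hmax⟩ := exists_max_image _ Prod.fst hne
      simp only [mem_filter, YoungDiagram.mem_cells] at hd hmax
      refine mem_image.2 ⟨d, ?_, hd.2⟩
      simp only [mem_filter, YoungDiagram.mem_cells]
      refine ⟨⟨hd.1.1, fun h => ?_⟩, hd.1.2⟩
      have := hmax (d.1 + 1, d.2) ⟨⟨h.1, h.2.symm.trans hd.1.2⟩, hd.2⟩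
      simp only at this
      omega
    · simp only [mem_filter] at hc ⊢
      exact ⟨hc.1.1, hc.2⟩
  rw [himage, card_image_of_injOn]
  have aux : ∀ i i' j, i < i' → (i', j) ∈ L → Q.entry i j = k → Q.entry i' j = k →
      Q.Repeats (i, j) := by
    intro i i' j hi hm h h'
    refine ⟨mem_of_le hm hi le_rfl, ?_⟩
    have h1 := Q.le_of_le hm hi le_rfl
    have h2 := Q.le_of_le (mem_of_le hm hi le_rfl) (Nat.le_succ i) (le_refl j)
    simp only [Nat.succ_eq_add_one] at h1 h2 ⊢
    omega
  rintro ⟨i, j⟩ hc ⟨i', j'⟩ hd rfl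
  simp only [coe_filter, mem_filter, YoungDiagram.mem_cells, Set.mem_ofPred_eq] at hc hd
  obtain h | rfl | h := lt_trichotomy i i'
  · exact absurd (aux i i' j h hd.1.1 hc.2 hd.2) hc.1.2
  · rfl
  · exact absurd (aux i' i j h hc.1.1 hd.2 hc.2) hd.1.2

/-- The contribution to the dual Grothendieck function. -/
def weight (b : A) (z : ℕ → A) (Q : ReversePlanePartition L) : A :=
  b ^ Q.repeats * powMonomial z Q.columnContent

theorem powMonomial_columnContent (Q : ReversePlanePartition L) (z : ℕ → A) :
    powMonomial z Q.columnContent =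
      ∏ c ∈ L.cells with ¬ Q.Repeats c, z (Q.entry c.1 c.2) := by
  rw [powMonomial, columnContent, Finsupp.onFinset_prod _ (by simp),
    prod_comp z (fun c : ℕ × ℕ => Q.entry c.1 c.2)]
  simp only [card_columns]
  refine (prod_subset (image_subset_image (filter_subset _ _)) fun k _ hk => ?_).symm
  rw [card_eq_zero.2, pow_zero]
  rw [filter_eq_empty_iff]
  exact fun c hc h => hk (mem_image.2 ⟨c, hc, h⟩)

theorem weight_eq_prod (b : A) (z : ℕ → A) (Q : ReversePlanePartition L) :
    Q.weight b z = ∏ c ∈ L.cells, if Q.Repeats c then b else z (Q.entry c.1 c.2) := by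
  rw [weight, powMonomial_columnContent, prod_ite, prod_const]
  rfl

/-- The entries at most `N`. -/
def restrict (Q : ReversePlanePartition L) (N : ℕ) (M : YoungDiagram) (h : Q.cut N = M) :
    ReversePlanePartition M where
  entry i j := if (i, j) ∈ M then Q.entry i j else 0
  pos i j hm := by
    subst h
    rw [if_pos hm]
    exact Q.pos i j (mem_cut.1 hm).1
  col_weak i i' j hi hm hm' := by
    subst h
    rw [if_pos hm, if_pos hm']
    exact Q.le_of_le (mem_cut.1 hm').1 hi.le le_rfl
  row_weak i j j' hj hm hm' := by
    subst h
    rw [if_pos hm, if_pos hm']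
    exact Q.le_of_le (mem_cut.1 hm').1 le_rfl hj.le
  zero_outside i j hm := if_neg hm

/-- The reverse plane partition with the entry `N + 1` in all new boxes. -/
def extend (Q : ReversePlanePartition M) (N : ℕ) (hQ : Q.Bounded N)
    (hML : ∀ i, M.rowLen i ≤ L.rowLen i) : ReversePlanePartition L where
  entry i j := if (i, j) ∈ M then Q.entry i j else if (i, j) ∈ L then N + 1 else 0
  pos i j hm := by
    split_ifs with h
    · exact Q.pos i j h
    · omega
  col_weak i i' j hi hm hm' := by
    rw [if_pos hm, if_pos hm']
    have := hQ i j
    split_ifs with h h' h'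
    · exact Q.le_of_le h' hi.le le_rfl
    · omega
    · exact absurd (mem_of_le h' hi.le le_rfl) h
    · exact le_rfl
  row_weak i j j' hj hm hm' := by
    rw [if_pos hm, if_pos hm']
    have := hQ i j
    split_ifs with h h' h'
    · exact Q.le_of_le h' le_rfl hj.le
    · omega
    · exact absurd (mem_of_le h' le_rfl hj.le) h
    · exact le_rfl
  zero_outside i j hm := by
    have : (i, j) ∉ M := by
      have := hML i
      rw [YoungDiagram.mem_iff_lt_rowLen] at hm ⊢
      omega
    rw [if_neg this, if_neg hm]

section Extend

variable {Q : ReversePlanePartition M} {N : ℕ} {hQ : Q.Bounded N}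
  {hML : ∀ i, M.rowLen i ≤ L.rowLen i}

theorem bounded_extend : (Q.extend N hQ hML).Bounded (N + 1) := by
  intro i j
  have := hQ i j
  simp only [extend]
  split_ifs <;> omega

theorem cut_extend : (Q.extend N hQ hML).cut N = M := by
  ext ⟨i, j⟩
  have h1 := hQ i j
  have h2 := hML i
  rw [YoungDiagram.mem_cells, YoungDiagram.mem_cells, mem_cut]
  simp only [extend]
  by_cases h : (i, j) ∈ M
  · simp only [h, if_true, iff_true]
    rw [YoungDiagram.mem_iff_lt_rowLen] at h ⊢
    omega
  · by_cases hL : (i, j) ∈ L <;> simp [h, hL]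

theorem restrict_extend : (Q.extend N hQ hML).restrict N M cut_extend = Q := by
  ext i j
  by_cases h : (i, j) ∈ M
  · simp [restrict, extend, h]
  · simp [restrict, h, Q.zero_outside i j h]

/-- The box below a new box is new whenever it lies in `L`, so the new repeats are the new boxes
with a lower neighbour. Old boxes keep their status, since their entries are at most `N`. -/
theorem weight_extend {n : ℕ} (hL : ∀ i, n ≤ i → L.rowLen i = 0) (b : A) (z : ℕ → A) :
    (Q.extend N hQ hML).weight b z =
      (∏ i ∈ range n, (b ^ (L.rowLen (i + 1) - M.rowLen i) *
        z (N + 1) ^ (L.rowLen i - max (M.rowLen i) (L.rowLen (i + 1))))) * Q.weight b z := by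
  have hsub : M.cells ⊆ L.cells := by
    rintro ⟨i, j⟩
    rw [YoungDiagram.mem_cells, YoungDiagram.mem_cells, YoungDiagram.mem_iff_lt_rowLen,
      YoungDiagram.mem_iff_lt_rowLen]
    exact fun h => h.trans_le (hML i)
  have hnew : ∀ c ∈ L.cells \ M.cells, (if (Q.extend N hQ hML).Repeats c then b else
      z ((Q.extend N hQ hML).entry c.1 c.2)) =
      if c.2 < L.rowLen (c.1 + 1) then b else z (N + 1) := by
    rintro ⟨i, j⟩ hc
    rw [mem_sdiff, YoungDiagram.mem_cells, YoungDiagram.mem_cells] at hc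
    have hentry : (Q.extend N hQ hML).entry i j = N + 1 := by
      simp [extend, hc]
    have hrep : (Q.extend N hQ hML).Repeats (i, j) ↔ j < L.rowLen (i + 1) := by
      rw [Repeats, hentry, YoungDiagram.mem_iff_lt_rowLen, and_iff_left_iff_imp]
      intro h
      have h1 : (i + 1, j) ∉ M := fun h' => hc.2 (mem_of_le h' (Nat.le_succ i) le_rfl)
      simp [extend, h1, YoungDiagram.mem_iff_lt_rowLen.2 h]
    simp only [hrep, hentry]
  have hold : ∀ c ∈ M.cells, (if (Q.extend N hQ hML).Repeats c then b else
      z ((Q.extend N hQ hML).entry c.1 c.2)) =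
      if Q.Repeats c then b else z (Q.entry c.1 c.2) := by
    rintro ⟨i, j⟩ hc
    rw [YoungDiagram.mem_cells] at hc
    have hentry : (Q.extend N hQ hML).entry i j = Q.entry i j := by
      simp [extend, hc]
    have hrep : (Q.extend N hQ hML).Repeats (i, j) ↔ Q.Repeats (i, j) := by
      rw [Repeats, Repeats, hentry]
      by_cases h : (i + 1, j) ∈ M
      · have h' : (i + 1, j) ∈ L := by
          rw [← YoungDiagram.mem_cells] at h ⊢
          exact hsub h
        simp [extend, h, h']
      · simp only [h, false_and, iff_false, not_and]
        intro h'
        have := hQ i j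
        simp only [extend, h, h', if_true, if_false]
        omega
    simp only [hrep, hentry]
  rw [weight_eq_prod, ← prod_sdiff hsub, prod_congr rfl hnew, prod_congr rfl hold,
    ← weight_eq_prod, prod_cells_sdiff hL]
  congr 1
  refine prod_congr rfl fun i _ => ?_
  rw [prod_ite, prod_const, prod_const]
  have h0 := hML i
  have h1 := L.rowLen_anti i (i + 1) (Nat.le_succ i)
  have e1 : (Ico (M.rowLen i) (L.rowLen i)).filter (fun j => j < L.rowLen (i + 1)) =
      Ico (M.rowLen i) (L.rowLen (i + 1)) := by
    ext j; simp only [mem_filter, mem_Ico]; omega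
  have e2 : (Ico (M.rowLen i) (L.rowLen i)).filter (fun j => ¬ j < L.rowLen (i + 1)) =
      Ico (max (M.rowLen i) (L.rowLen (i + 1))) (L.rowLen i) := by
    ext j; simp only [mem_filter, mem_Ico]; omega
  rw [e1, e2, Nat.card_Ico, Nat.card_Ico]

end Extend

theorem bounded_restrict {Q : ReversePlanePartition L} {N : ℕ} (h : Q.cut N = M) :
    (Q.restrict N M h).Bounded N := by
  subst h
  intro i j
  simp only [restrict]
  split_ifs with h
  · exact (mem_cut.1 h).2
  · exact Nat.zero_le _

theorem extend_restrict {Q : ReversePlanePartition L} {N : ℕ} (hQ : Q.Bounded (N + 1))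
    (h : Q.cut N = M) (hQ' : (Q.restrict N M h).Bounded N)
    (hML : ∀ i, M.rowLen i ≤ L.rowLen i) : (Q.restrict N M h).extend N hQ' hML = Q := by
  subst h
  ext i j
  simp only [extend, restrict]
  split_ifs with h h'
  · rfl
  · have h1 := hQ i j
    have h2 : ¬ Q.entry i j ≤ N := fun h2 => h (mem_cut.2 ⟨h', h2⟩)
    omega
  · exact (Q.zero_outside i j h').symm

open Classical in
theorem sum_weight_cut (n N : ℕ) (hML : ∀ i, M.rowLen i ≤ L.rowLen i)
    (hL : ∀ i, n ≤ i → L.rowLen i = 0) (b : A) (z : ℕ → A) :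
    ∑ Q ∈ bounded L (N + 1) with Q.cut N = M, Q.weight b z =
      (∏ i ∈ range n, (b ^ (L.rowLen (i + 1) - M.rowLen i) *
        z (N + 1) ^ (L.rowLen i - max (M.rowLen i) (L.rowLen (i + 1))))) *
      ∑ Q ∈ bounded M N, Q.weight b z := by
  rw [mul_sum]
  symm
  refine sum_bij' (fun Q hQ => Q.extend N (mem_bounded.1 hQ) hML)
    (fun Q hQ => Q.restrict N M (mem_filter.1 hQ).2) ?_ ?_ ?_ ?_ ?_
  · intro Q hQ
    rw [mem_filter, mem_bounded]
    exact ⟨bounded_extend, cut_extend⟩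
  · intro Q hQ
    rw [mem_bounded]
    exact bounded_restrict (mem_filter.1 hQ).2
  · intro Q hQ
    exact restrict_extend
  · intro Q hQ
    exact extend_restrict (mem_bounded.1 (mem_filter.1 hQ).1) (mem_filter.1 hQ).2 _ _
  · intro Q hQ
    rw [weight_extend hL]

theorem rowList_zero (n : ℕ) : rowList (fun _ => 0) n = List.replicate n 0 := by
  induction n with
  | zero => rfl
  | succ n ih => rw [rowList, ih, List.replicate_succ]

/-- One letter can fill any number of rows here, so the number `n` of rows is independent of the
number `N` of letters and stays fixed in the induction. -/
theorem sum_weight_bounded (b : A) (z : ℕ → A) (w n N : ℕ) (L : YoungDiagram)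
    (hw : L.rowLen 0 ≤ w) (hL : ∀ i, n ≤ i → L.rowLen i = 0) :
    ∑ Q ∈ bounded L N, Q.weight b z = dualGrothendieckList w n b z N (rowList L.rowLen n) := by
  classical
  induction N generalizing L with
  | zero =>
    rw [dualGrothendieckList, ← rowList_zero]
    simp only [rowList_congr]
    split_ifs with h
    · have hzero : ∀ i, L.rowLen i = 0 := fun i => by
        by_cases hi : i < n
        · exact h i hi
        · exact hL i (by omega)
      have hnot : ∀ i j, (i, j) ∉ L := fun i j h => by
        rw [YoungDiagram.mem_iff_lt_rowLen, hzero i] at h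
        omega
      have hcells : L.cells = ∅ := eq_empty_iff_forall_notMem.2 fun c => hnot c.1 c.2
      let Q₀ : ReversePlanePartition L :=
        { entry := fun _ _ => 0
          pos := fun i j h => absurd h (hnot i j)
          col_weak := by simp
          row_weak := by simp
          zero_outside := fun _ _ _ => rfl }
      have : bounded L 0 = {Q₀} := by
        ext Q
        rw [mem_bounded, mem_singleton]
        constructor
        · intro _
          ext i j
          exact Q.zero_outside i j (hnot i j)
        · rintro rfl i j
          exact le_rfl
      rw [this, sum_singleton, weight_eq_prod, hcells, prod_empty]
    · refine sum_eq_zero fun Q hQ => absurd (fun i _ => ?_) h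
      by_contra h0
      have h1 := Q.pos i 0 (YoungDiagram.mem_iff_lt_rowLen.2 (by omega))
      have h2 := mem_bounded.1 hQ i 0
      omega
  | succ N ih =>
    rw [← sum_fiberwise_of_maps_to (t := box w n) (g := fun Q => rowList (Q.cut N).rowLen n)
      fun Q _ => rowList_mem_box n fun i =>
        (Q.rowLen_cut_le N i).trans ((L.rowLen_anti 0 i (Nat.zero_le i)).trans hw)]
    rw [dualGrothendieckList]
    refine sum_congr rfl fun l hl => ?_
    obtain ⟨g, rfl, hg⟩ := exists_rowList (mem_box.1 hl).1
    rw [rppKernel_rowList _ _ _ _ _ (hL n le_rfl) (hg n le_rfl)]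
    split_ifs with hi
    · have hanti : Antitone g := by
        refine antitone_nat_of_succ_le fun i => ?_
        by_cases h : i < n
        · exact (hi i h).2.2
        · rw [hg (i + 1) (by omega)]
          exact Nat.zero_le _
      have hrow := rowLen_diagramOfRows hanti hg
      set M := diagramOfRows g hanti n
      have hML : ∀ i, M.rowLen i ≤ L.rowLen i := by
        intro i
        rw [hrow]
        by_cases h : i < n
        · exact (hi i h).1
        · rw [hg i (by omega)]
          exact Nat.zero_le _
      have hcut : ∀ Q : ReversePlanePartition L, rowList (Q.cut N).rowLen n = rowList g n ↔
          Q.cut N = M := by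
        intro Q
        rw [rowList_congr, ← hrow]
        constructor
        · intro h
          refine diagram_ext fun i => ?_
          by_cases hn : i < n
          · exact h i hn
          · have h1 := Q.rowLen_cut_le N i
            rw [hL i (by omega)] at h1
            rw [hrow, hg i (by omega)]
            omega
        · intro h i _
          rw [h]
      have hM0 : ∀ i, n ≤ i → M.rowLen i = 0 := by rwa [hrow]
      rw [filter_congr fun Q _ => hcut Q, sum_weight_cut n N hML hL, ih M ((hML 0).trans hw) hM0,
        hrow]
    · rw [zero_mul]
      refine sum_eq_zero fun Q hQ => ?_
      rw [mem_filter, mem_bounded, rowList_congr] at hQ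
      refine absurd (fun i h => ?_) hi
      rw [← hQ.2 i h]
      refine ⟨Q.rowLen_cut_le N i, L.rowLen_anti i (i + 1) (Nat.le_succ i), ?_⟩
      by_cases h' : i + 1 < n
      · rw [← hQ.2 (i + 1) h']
        exact (Q.cut N).rowLen_anti i (i + 1) (Nat.le_succ i)
      · rw [hg (i + 1) (by omega)]
        exact Nat.zero_le _

end ReversePlanePartition
end ReversePlane

/-! ### Column-strict tableaux as the case without excess or repeats -/

namespace ColumnStrictTableau

variable {L : YoungDiagram} {A : Type*} [CommRing A]

/-- A column-strict tableau, as a set-valued tableau. -/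
def toSetValued (T : ColumnStrictTableau L) : SetValuedTableau L where
  entry i j := if (i, j) ∈ L then {T.1 i j} else ∅
  nonempty i j hm := by simp [hm]
  pos i j a ha := by
    split_ifs at ha with hm
    · rw [mem_singleton.1 ha]
      exact T.2 i j hm
    · simp at ha
  col_strict i i' j hi hm hm' a ha b hb := by
    rw [if_pos hm, mem_singleton] at ha
    rw [if_pos hm', mem_singleton] at hb
    rw [ha, hb]
    exact T.1.col_strict hi hm'
  row_weak i j j' hj hm hm' a ha b hb := by
    rw [if_pos hm, mem_singleton] at ha
    rw [if_pos hm', mem_singleton] at hb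
    rw [ha, hb]
    exact T.1.row_weak hj hm'
  empty_outside i j hm := if_neg hm

/-- A column-strict tableau, as a reverse plane partition. -/
def toReversePlane (T : ColumnStrictTableau L) : ReversePlanePartition L where
  entry i j := T.1 i j
  pos := T.2
  col_weak _ _ _ hi _ hm' := (T.1.col_strict hi hm').le
  row_weak _ _ _ hj _ hm' := T.1.row_weak hj hm'
  zero_outside _ _ hm := T.1.zeros hm

theorem ext {T T' : ColumnStrictTableau L} (h : ∀ i j, (i, j) ∈ L → T.1 i j = T'.1 i j) :
    T = T' := by
  refine Subtype.ext (SemistandardYoungTableau.ext fun i j => ?_)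
  by_cases hm : (i, j) ∈ L
  · exact h i j hm
  · rw [T.1.zeros hm, T'.1.zeros hm]

theorem toSetValued_injective : Function.Injective (toSetValued (L := L)) := by
  intro T T' h
  refine ext fun i j hm => ?_
  have := congrArg (fun P => P.entry i j) h
  simpa [toSetValued, hm] using this

theorem toReversePlane_injective : Function.Injective (toReversePlane (L := L)) := by
  intro T T' h
  exact ext fun i j _ => congrArg (fun Q => Q.entry i j) h

theorem excess_toSetValued (T : ColumnStrictTableau L) : T.toSetValued.excess = 0 := by
  refine sum_eq_zero fun c hc => ?_
  simp [toSetValued, (YoungDiagram.mem_cells c).1 hc]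

theorem content_toSetValued (T : ColumnStrictTableau L) : T.toSetValued.content = T.content := by
  ext k
  simp only [SetValuedTableau.content, content, Finsupp.onFinset_apply]
  congr 1
  refine filter_congr fun c hc => ?_
  simp [toSetValued, (YoungDiagram.mem_cells c).1 hc, eq_comm]

theorem not_repeats_toReversePlane (T : ColumnStrictTableau L) (c : ℕ × ℕ) :
    ¬ T.toReversePlane.Repeats c := fun h =>
  (T.1.col_strict (Nat.lt_succ_self c.1) h.1).ne h.2

theorem repeats_toReversePlane (T : ColumnStrictTableau L) : T.toReversePlane.repeats = 0 :=
  card_eq_zero.2 (filter_eq_empty_iff.2 fun c _ => T.not_repeats_toReversePlane c)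

theorem columnContent_toReversePlane (T : ColumnStrictTableau L) :
    T.toReversePlane.columnContent = T.content := by
  ext k
  simp only [ReversePlanePartition.columnContent, content, Finsupp.onFinset_apply,
    ReversePlanePartition.card_columns, not_repeats_toReversePlane, not_false_eq_true,
    filter_true]
  rfl

theorem exists_toSetValued {P : SetValuedTableau L} (h : P.excess = 0) :
    ∃ T : ColumnStrictTableau L, T.toSetValued = P := by
  have hcard : ∀ i j, (i, j) ∈ L → ∃ a, P.entry i j = {a} := by
    intro i j hm
    have h1 := (sum_eq_zero_iff.1 h) (i, j) ((YoungDiagram.mem_cells _).2 hm)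
    have h2 := (P.nonempty i j hm).card_pos
    exact card_eq_one.1 (by simp only at h1; omega)
  -- The sum reads off the element of a singleton, and its value on the empty set is the `0`
  -- required outside the diagram.
  have hmem : ∀ i j, (i, j) ∈ L → P.entry i j = {∑ a ∈ P.entry i j, a} := by
    intro i j hm
    obtain ⟨a, ha⟩ := hcard i j hm
    simp [ha]
  have hmem' : ∀ i j, (i, j) ∈ L → ∑ a ∈ P.entry i j, a ∈ P.entry i j := by
    intro i j hm
    obtain ⟨a, ha⟩ := hcard i j hm
    simp [ha]
  refine ⟨⟨⟨fun i j => ∑ a ∈ P.entry i j, a, ?_, ?_, ?_⟩, ?_⟩, ?_⟩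
  · intro i j j' hj hm
    have hm' : (i, j) ∈ L := mem_of_le hm le_rfl hj.le
    exact P.row_weak i j j' hj hm' hm _ (hmem' i j hm') _ (hmem' i j' hm)
  · intro i i' j hi hm
    have hm' : (i, j) ∈ L := mem_of_le hm hi.le le_rfl
    exact P.col_strict i i' j hi hm' hm _ (hmem' i j hm') _ (hmem' i' j hm)
  · intro i j hm
    simp [P.empty_outside i j hm]
  · intro i j hm
    exact P.pos i j _ (hmem' i j hm)
  · ext1
    funext i j
    by_cases hm : (i, j) ∈ L
    · simp only [toSetValued, hm, if_true]
      exact (hmem i j hm).symm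
    · simp only [toSetValued, hm, if_false]
      exact (P.empty_outside i j hm).symm

theorem exists_toReversePlane {Q : ReversePlanePartition L} (h : Q.repeats = 0) :
    ∃ T : ColumnStrictTableau L, T.toReversePlane = Q := by
  have hne : ∀ i j, (i + 1, j) ∈ L → Q.entry i j ≠ Q.entry (i + 1) j := by
    intro i j hm heq
    exact (filter_eq_empty_iff.1 (card_eq_zero.1 h))
      ((YoungDiagram.mem_cells (i, j)).2 (mem_of_le hm (Nat.le_succ i) le_rfl)) ⟨hm, heq⟩
  refine ⟨⟨⟨Q.entry, ?_, ?_, fun {i j} => Q.zero_outside i j⟩, Q.pos⟩, rfl⟩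
  · intro i j j' hj hm
    exact Q.le_of_le hm le_rfl hj.le
  · intro i i' j hi hm
    have hm' : (i + 1, j) ∈ L := mem_of_le hm hi le_rfl
    have h1 := Q.le_of_le hm' (Nat.le_succ i) (le_refl j)
    have h2 := Q.le_of_le hm hi (le_refl j)
    have h3 := hne i j hm'
    simp only [Nat.succ_eq_add_one] at h1 h2
    omega

variable [TopologicalSpace A]

/-- The factor `0 ^ P.excess` confines the support to the image of the column-strict tableaux, so
the sums agree without any summability. -/
theorem tsum_weight_zero_setValued (z : ℕ → A) :
    ∑' P : SetValuedTableau L, P.weight 0 z = schur L z := by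
  rw [schur, ← toSetValued_injective.tsum_eq]
  · refine tsum_congr fun T => ?_
    rw [SetValuedTableau.weight, excess_toSetValued, content_toSetValued]
    simp
  · intro P hP
    refine exists_toSetValued ?_
    by_contra h
    exact hP (by simp [SetValuedTableau.weight, h])

theorem tsum_weight_zero_reversePlane (z : ℕ → A) :
    ∑' Q : ReversePlanePartition L, Q.weight 0 z = schur L z := by
  rw [schur, ← toReversePlane_injective.tsum_eq]
  · refine tsum_congr fun T => ?_
    rw [ReversePlanePartition.weight, repeats_toReversePlane, columnContent_toReversePlane]
    simp
  · intro Q hQ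
    refine exists_toReversePlane ?_
    by_contra h
    exact hQ (by simp [ReversePlanePartition.weight, h])

end ColumnStrictTableau

/-! ### The identity for pairs with bounded entries -/

section FiniteIdentity

variable {A : Type*} [CommRing A]

theorem finite_diagrams (w N : ℕ) :
    {L : Diagrams w | ∀ i, N ≤ i → L.1.rowLen i = 0}.Finite := by
  refine Set.Finite.of_injOn (f := fun L => rowList L.1.rowLen N) (t := ↑(box w N)) ?_ ?_
    (box w N).finite_toSet
  · intro L _
    exact rowList_mem_box N fun i => (L.1.rowLen_anti 0 i (Nat.zero_le i)).trans L.2.le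
  · intro L hL M hM h
    refine Subtype.ext (diagram_ext fun i => ?_)
    by_cases hi : i < N
    · exact rowList_congr.1 h i hi
    · rw [hL i (by omega), hM i (by omega)]

/-- The pairs whose entries are at most `N`. -/
def boundedPairs (w N : ℕ) : Finset (Pairs w) :=
  (finite_diagrams w N).toFinset.sigma fun L =>
    SetValuedTableau.bounded L.1 N ×ˢ ReversePlanePartition.bounded L.1 N

/-- The bound on the number of rows is automatic, because the set-valued tableau is column-strict.
-/
theorem mem_boundedPairs {w N : ℕ} {p : Pairs w} :
    p ∈ boundedPairs w N ↔ p.2.1.Bounded N ∧ p.2.2.Bounded N := by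
  rw [boundedPairs, mem_sigma, mem_product, SetValuedTableau.mem_bounded,
    ReversePlanePartition.mem_bounded, Set.Finite.mem_toFinset, and_iff_right_iff_imp]
  exact fun h i hi => SetValuedTableau.rowLen_eq_zero_of_bounded h.1 hi

/-- The box also contains lists that are not partitions; the interlacing conditions of the last
kernel make their terms vanish. -/
theorem antitone_of_grothendieckList_ne_zero {w n : ℕ} {b : A} {x : ℕ → A} {f : ℕ → ℕ}
    (hf : ∀ i, n ≤ i → f i = 0) (h : grothendieckList w b x n (rowList f n) ≠ 0) : Antitone f := by
  refine antitone_nat_of_succ_le fun i => ?_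
  obtain _ | n := n
  · rw [hf (i + 1) (Nat.zero_le _)]
    exact Nat.zero_le _
  · obtain ⟨l, hl, hne⟩ := exists_ne_zero_of_sum_ne_zero h
    obtain ⟨g, rfl, -⟩ := exists_rowList (mem_box.1 hl).1
    rw [svKernel_rowList] at hne
    split_ifs at hne with hi
    · by_cases hin : i < n
      · exact (hi i hin).2.trans (hi i hin).1
      · rw [hf (i + 1) (by omega)]
        exact Nat.zero_le _
    · simp at hne

theorem sum_boundedPairs (w N : ℕ) (b : A) (x y : ℕ → A) :
    ∑ p ∈ boundedPairs w N, p.2.1.weight b x * p.2.2.weight b y =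
      ∑ l ∈ box w N with hd l = w,
        grothendieckList w b x N l * dualGrothendieckList w N b y N l := by
  rw [boundedPairs, sum_sigma]
  refine sum_of_injOn (fun L => rowList L.1.rowLen N) ?_ ?_ ?_ ?_
  · intro L hL M hM h
    rw [Set.Finite.coe_toFinset] at hL hM
    refine Subtype.ext (diagram_ext fun i => ?_)
    by_cases hi : i < N
    · exact rowList_congr.1 h i hi
    · rw [hL i (by omega), hM i (by omega)]
  · intro L hL
    rw [Set.Finite.coe_toFinset] at hL
    refine mem_coe.2 (mem_filter.2 ⟨rowList_mem_box N fun i =>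
      (L.1.rowLen_anti 0 i (Nat.zero_le i)).trans L.2.le, ?_⟩)
    rw [hd_rowList (hL N le_rfl), L.2]
  · intro l hl hne
    rw [mem_filter] at hl
    by_contra h0
    obtain ⟨f, rfl, hf⟩ := exists_rowList (mem_box.1 hl.1).1
    have hanti := antitone_of_grothendieckList_ne_zero hf (left_ne_zero_of_mul h0)
    have hrow := rowLen_diagramOfRows hanti hf
    refine hne ⟨⟨diagramOfRows f hanti N, ?_⟩, ?_, ?_⟩
    · rw [hrow, ← hl.2, hd_rowList (hf N le_rfl)]
    · rw [Set.Finite.coe_toFinset]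
      intro i hi
      simp only [hrow, hf i hi]
    · simp only [hrow]
  · intro L hL
    rw [Set.Finite.mem_toFinset] at hL
    rw [sum_product, ← SetValuedTableau.sum_weight_bounded b x w N L.1 L.2.le hL,
      ← ReversePlanePartition.sum_weight_bounded b y w N N L.1 L.2.le hL, sum_mul_sum]

theorem sum_boundedPairs_eq (w N : ℕ) (b : A) (x y : ℕ → A) :
    ∑ p ∈ boundedPairs w N, p.2.1.weight b x * p.2.2.weight b y =
      ∑ p ∈ boundedPairs w N, p.2.1.weight 0 x * p.2.2.weight 0 y := by
  rw [sum_boundedPairs, sum_boundedPairs, cauchy_list]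

end FiniteIdentity

/-! ### Passage to formal power series -/

section Topology

variable {R : Type*} [CommRing R]

theorem powMonomial_X (s : ℕ → ℕ ⊕ ℕ) (α : ℕ →₀ ℕ) :
    powMonomial (fun k => (MvPowerSeries.X (s k) : Series R)) α =
      MvPowerSeries.monomial (α.mapDomain s) 1 := by
  induction α using Finsupp.induction_linear with
  | zero => simp [powMonomial]
  | add f g hf hg =>
    rw [powMonomial, Finsupp.prod_add_index' (by simp) (by simp [pow_add])]
    rw [powMonomial] at hf hg
    rw [hf, hg, Finsupp.mapDomain_add, MvPowerSeries.monomial_mul_monomial, one_mul]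
  | single k e =>
    rw [powMonomial, Finsupp.prod_single_index (by simp), Finsupp.mapDomain_single,
      MvPowerSeries.X_pow_eq]

theorem const_zero : (const 0 : Series R) = 0 := map_zero _

theorem neg_const_pow (β : R) (n : ℕ) : (-const β) ^ n = (const ((-β) ^ n) : Series R) := by
  rw [const, const, map_pow, map_neg]

theorem const_pow (β : R) (n : ℕ) : const β ^ n = (const (β ^ n) : Series R) := by
  rw [const, const, map_pow]

theorem eq_of_coeff_const_mul_monomial_ne_zero {a : R} {d e : ℕ ⊕ ℕ →₀ ℕ}
    (h : MvPowerSeries.coeff d (const a * MvPowerSeries.monomial e 1) ≠ 0) : e = d := by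
  classical
  rw [const, MvPowerSeries.coeff_C_mul, MvPowerSeries.coeff_monomial] at h
  by_contra hne
  simp [Ne.symm hne] at h

/-- The exponent of `x ^ μ(P) * y ^ ν(Q)`. -/
def Pairs.exponent {w : ℕ} (p : Pairs w) : ℕ ⊕ ℕ →₀ ℕ :=
  p.2.1.content.mapDomain Sum.inl + p.2.2.columnContent.mapDomain Sum.inr

theorem Pairs.weight_eq (β : R) {w : ℕ} (p : Pairs w) :
    p.weight β = const ((-β) ^ p.2.1.excess * β ^ p.2.2.repeats) *
      MvPowerSeries.monomial p.exponent 1 := by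
  have hx := powMonomial_X (R := R) Sum.inl p.2.1.content
  have hy := powMonomial_X (R := R) Sum.inr p.2.2.columnContent
  rw [Pairs.weight, show xVar R = fun k => MvPowerSeries.X (Sum.inl k) from rfl,
    show yVar R = fun k => MvPowerSeries.X (Sum.inr k) from rfl, hx, hy, neg_const_pow, const_pow,
    mul_mul_mul_comm, MvPowerSeries.monomial_mul_monomial, one_mul, exponent]
  congr 1
  rw [const, const, const, map_mul]

theorem SetValuedTableau.bounded_of_content {L : YoungDiagram} {P : SetValuedTableau L} {N : ℕ}
    (h : ∀ k, P.content k ≠ 0 → k ≤ N) : P.Bounded N := by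
  intro i j a ha
  refine h a (card_ne_zero.2 ⟨(i, j), ?_⟩)
  exact mem_filter.2 ⟨(YoungDiagram.mem_cells _).2 (P.mem_of_mem_entry ha), ha⟩

theorem ReversePlanePartition.bounded_of_columnContent {L : YoungDiagram}
    {Q : ReversePlanePartition L} {N : ℕ} (h : ∀ k, Q.columnContent k ≠ 0 → k ≤ N) :
    Q.Bounded N := by
  intro i j
  by_cases hm : (i, j) ∈ L
  · refine h _ (card_ne_zero.2 ⟨j, mem_image.2 ⟨(i, j), ?_, rfl⟩⟩)
    exact mem_filter.2 ⟨(YoungDiagram.mem_cells _).2 hm, rfl⟩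
  · rw [Q.zero_outside i j hm]
    exact Nat.zero_le _

/-- The largest index of a variable with nonzero exponent. -/
def maxIndex (d : ℕ ⊕ ℕ →₀ ℕ) : ℕ := d.support.sup (Sum.elim id id)

theorem le_maxIndex {d : ℕ ⊕ ℕ →₀ ℕ} {v : ℕ ⊕ ℕ} (h : d v ≠ 0) : Sum.elim id id v ≤ maxIndex d :=
  le_sup (f := Sum.elim id id) (Finsupp.mem_support_iff.2 h)

/-- Every entry of a tableau occurs as the index of a variable in its monomial. Hence only finitely
many pairs share a given monomial. -/
theorem Pairs.mem_boundedPairs_exponent {w : ℕ} (p : Pairs w) :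
    p ∈ boundedPairs w (maxIndex p.exponent) := by
  rw [mem_boundedPairs]
  constructor
  · refine SetValuedTableau.bounded_of_content fun k hk => ?_
    refine le_maxIndex (v := Sum.inl k) ?_
    rw [exponent, Finsupp.add_apply, Finsupp.mapDomain_apply Sum.inl_injective]
    omega
  · refine ReversePlanePartition.bounded_of_columnContent fun k hk => ?_
    refine le_maxIndex (v := Sum.inr k) ?_
    rw [exponent, Finsupp.add_apply, Finsupp.mapDomain_apply Sum.inr_injective]
    omega

theorem finite_mapDomain_fiber {ι : Type*} {c : ι → ℕ →₀ ℕ} (hc : ∀ α, {i | c i = α}.Finite)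
    {s : ℕ → ℕ ⊕ ℕ} (hs : Function.Injective s) (d : ℕ ⊕ ℕ →₀ ℕ) :
    {i | (c i).mapDomain s = d}.Finite := by
  by_cases h : ∃ α : ℕ →₀ ℕ, α.mapDomain s = d
  · obtain ⟨α, rfl⟩ := h
    exact (hc α).subset fun i hi => Finsupp.mapDomain_injective hs hi
  · convert Set.finite_empty
    rw [Set.eq_empty_iff_forall_notMem]
    exact fun i hi => h ⟨_, hi⟩

theorem SetValuedTableau.finite_content (L : YoungDiagram) (α : ℕ →₀ ℕ) :
    {P : SetValuedTableau L | P.content = α}.Finite := by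
  refine (finite_bounded L (α.support.sup id)).subset fun P hP => ?_
  obtain rfl : P.content = α := hP
  exact bounded_of_content fun k hk => le_sup (f := id) (Finsupp.mem_support_iff.2 hk)

theorem ReversePlanePartition.finite_columnContent (L : YoungDiagram) (α : ℕ →₀ ℕ) :
    {Q : ReversePlanePartition L | Q.columnContent = α}.Finite := by
  refine (finite_bounded L (α.support.sup id)).subset fun Q hQ => ?_
  obtain rfl : Q.columnContent = α := hQ
  exact bounded_of_columnContent fun k hk => le_sup (f := id) (Finsupp.mem_support_iff.2 hk)

theorem ColumnStrictTableau.finite_content (L : YoungDiagram) (α : ℕ →₀ ℕ) :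
    {T : ColumnStrictTableau L | T.content = α}.Finite := by
  refine ((SetValuedTableau.finite_content L α).preimage toSetValued_injective.injOn).subset ?_
  intro T hT
  exact T.content_toSetValued.trans hT

theorem Pairs.weight_zero {w : ℕ} (p : Pairs w) :
    p.weight (0 : R) = if p.defect = 0 then p.monomial R else 0 := by
  rw [weight, monomial, defect, const_zero, neg_zero]
  by_cases h1 : p.2.1.excess = 0 <;> by_cases h2 : p.2.2.repeats = 0 <;> simp [h1, h2]

theorem Pairs.weight_of_defect {w : ℕ} {p : Pairs w} (β : R) (h : p.defect = 0) :
    p.weight β = p.monomial R := by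
  rw [defect, Nat.add_eq_zero_iff] at h
  simp [weight, monomial, h]

variable [TopologicalSpace R]

theorem summable_of_finite_fibers {ι : Type*} {f : ι → Series R}
    {e : ι → ℕ ⊕ ℕ →₀ ℕ} (hf : ∀ i d, MvPowerSeries.coeff d (f i) ≠ 0 → e i = d)
    (he : ∀ d, {i | e i = d}.Finite) : Summable f := by
  rw [MvPowerSeries.WithPiTopology.summable_iff_summable_coeff]
  exact fun d => summable_of_hasFiniteSupport ((he d).subset fun i hi => hf i d hi)

theorem coeff_tsum_eq_sum [T2Space R] {ι : Type*} {f : ι → Series R} (hf : Summable f)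
    {d : ℕ ⊕ ℕ →₀ ℕ} {s : Finset ι} (hs : ∀ i, i ∉ s → MvPowerSeries.coeff d (f i) = 0) :
    MvPowerSeries.coeff d (∑' i, f i) = MvPowerSeries.coeff d (∑ i ∈ s, f i) := by
  have h1 := MvPowerSeries.WithPiTopology.hasSum_iff_hasSum_coeff.1 hf.hasSum d
  rw [map_sum]
  exact h1.unique (hasSum_sum_of_ne_finset_zero hs)

theorem summable_const_mul_powMonomial {ι : Type*} {c : ι → ℕ →₀ ℕ}
    (hc : ∀ α, {i | c i = α}.Finite) {s : ℕ → ℕ ⊕ ℕ} (hs : Function.Injective s) (a : ι → R) :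
    Summable fun i => const (a i) * powMonomial (fun k => (MvPowerSeries.X (s k) : Series R)) (c i) := by
  refine summable_of_finite_fibers (e := fun i => (c i).mapDomain s) (fun i d h => ?_)
    (finite_mapDomain_fiber hc hs)
  rw [powMonomial_X] at h
  exact eq_of_coeff_const_mul_monomial_ne_zero h

theorem SetValuedTableau.summable_weight (L : YoungDiagram) (β : R) {s : ℕ → ℕ ⊕ ℕ}
    (hs : Function.Injective s) : Summable fun P : SetValuedTableau L =>
      P.weight (const β) fun k => (MvPowerSeries.X (s k) : Series R) := by
  simp only [weight, neg_const_pow]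
  exact summable_const_mul_powMonomial (finite_content L) hs _

theorem ReversePlanePartition.summable_weight (L : YoungDiagram) (β : R) {s : ℕ → ℕ ⊕ ℕ}
    (hs : Function.Injective s) : Summable fun Q : ReversePlanePartition L =>
      Q.weight (const β) fun k => (MvPowerSeries.X (s k) : Series R) := by
  simp only [weight, const_pow]
  exact summable_const_mul_powMonomial (finite_columnContent L) hs _

theorem ColumnStrictTableau.summable_powMonomial (L : YoungDiagram) {s : ℕ → ℕ ⊕ ℕ}
    (hs : Function.Injective s) : Summable fun T : ColumnStrictTableau L =>
      powMonomial (fun k => (MvPowerSeries.X (s k) : Series R)) T.content := by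
  have := summable_const_mul_powMonomial (finite_content L) hs fun _ => (1 : R)
  simpa [const] using this

/-- The reindexing map `g` covers at once all pairs, the pairs of a fixed shape, and the pairs with
a condition on the defect. -/
theorem Pairs.summable_weight_comp {ι : Type*} (β : R) {w : ℕ} {g : ι → Pairs w}
    (hg : Function.Injective g) : Summable fun i => (g i).weight β := by
  refine summable_of_finite_fibers (e := fun i => (g i).exponent) (fun i d h => ?_) fun d => ?_
  · rw [weight_eq] at h
    exact eq_of_coeff_const_mul_monomial_ne_zero h
  · refine ((boundedPairs w (maxIndex d)).finite_toSet.preimage hg.injOn).subset fun i hi => ?_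
    obtain rfl : (g i).exponent = d := hi
    exact mem_boundedPairs_exponent _

theorem Pairs.summable_weight (β : R) (w : ℕ) : Summable fun p : Pairs w => p.weight β :=
  summable_weight_comp β Function.injective_id

/-- The coefficient at `d` sees only pairs with entries at most `maxIndex d`, for which
`sum_boundedPairs_eq` applies. -/
theorem tsum_weight_eq_tsum_weight_zero [T2Space R] (β : R) (w : ℕ) :
    ∑' p : Pairs w, p.weight β = ∑' p : Pairs w, p.weight (0 : R) := by
  ext d
  have hzero : ∀ γ : R, ∀ p, p ∉ boundedPairs w (maxIndex d) →
      MvPowerSeries.coeff d (p.weight γ) = 0 := by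
    intro γ p hp
    by_contra h
    rw [Pairs.weight_eq] at h
    obtain rfl := eq_of_coeff_const_mul_monomial_ne_zero h
    exact hp p.mem_boundedPairs_exponent
  rw [coeff_tsum_eq_sum (Pairs.summable_weight β w) (hzero β),
    coeff_tsum_eq_sum (Pairs.summable_weight 0 w) (hzero 0)]
  congr 1
  have := sum_boundedPairs_eq w (maxIndex d) (const β) (xVar R) (yVar R)
  rw [← const_zero] at this
  exact this

theorem tsum_weight_zero_eq_tsum_monomial (w : ℕ) :
    ∑' p : Pairs w, p.weight (0 : R) =
      ∑' p : {p : Pairs w // p.defect = 0}, p.1.monomial R := by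
  rw [← Subtype.val_injective.tsum_eq (g := (Subtype.val : {p : Pairs w // p.defect = 0} → Pairs w))]
  · exact tsum_congr fun p => by rw [Pairs.weight_of_defect 0 p.2]
  · intro p hp
    refine ⟨⟨p, ?_⟩, rfl⟩
    by_contra h
    exact hp (by simp only [Pairs.weight_zero, if_neg h])

variable [DiscreteTopology R]

theorem hasSum_grothendieck_mul_dualGrothendieck (β : R) (w : ℕ) :
    HasSum (fun L : Diagrams w => grothendieck L.1 (const β) (xVar R) *
      dualGrothendieck L.1 (const β) (yVar R)) (∑' p : Pairs w, p.weight β) := by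
  have hfib : ∀ L : Diagrams w,
      Summable fun q : SetValuedTableau L.1 × ReversePlanePartition L.1 =>
        Pairs.weight β (⟨L, q⟩ : Pairs w) := fun L =>
    Pairs.summable_weight_comp β (g := fun q => (⟨L, q⟩ : Pairs w)) fun q r h => by simpa using h
  have heq : ∀ L : Diagrams w, grothendieck L.1 (const β) (xVar R) *
      dualGrothendieck L.1 (const β) (yVar R) =
      ∑' q : SetValuedTableau L.1 × ReversePlanePartition L.1,
        Pairs.weight β (⟨L, q⟩ : Pairs w) := fun L =>
    (SetValuedTableau.summable_weight L.1 β Sum.inl_injective).tsum_mul_tsum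
      (ReversePlanePartition.summable_weight L.1 β Sum.inr_injective) (hfib L)
  simp only [heq]
  exact (Pairs.summable_weight β w).hasSum.sigma fun L => (hfib L).hasSum

/-- This is the preceding result at `β = 0`, where both generating functions become Schur functions.
-/
theorem hasSum_schur_mul_schur (w : ℕ) :
    HasSum (fun L : Diagrams w => schur L.1 (xVar R) * schur L.1 (yVar R))
      (∑' p : Pairs w, p.weight (0 : R)) := by
  have := hasSum_grothendieck_mul_dualGrothendieck (0 : R) w
  rw [const_zero] at this
  convert this using 3 with L
  · exact (ColumnStrictTableau.tsum_weight_zero_setValued _).symm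
  · exact (ColumnStrictTableau.tsum_weight_zero_reversePlane _).symm

/-- The pairs of defect zero already account for the whole sum, so the complementary sum vanishes by
subtraction; no sign-reversing involution is involved. -/
theorem tsum_weight_defect_pos (β : R) (w : ℕ) :
    ∑' p : {p : Pairs w // 0 < p.defect}, p.1.weight β = 0 := by
  have hadd := Summable.tsum_add_tsum_compl (s := {p : Pairs w | p.defect = 0})
    (f := fun p : Pairs w => p.weight β)
    (Pairs.summable_weight_comp β Subtype.val_injective)
    (Pairs.summable_weight_comp β Subtype.val_injective)
  have hzero : ∑' p : ↥{p : Pairs w | p.defect = 0}, p.1.weight β =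
      ∑' p : {p : Pairs w // p.defect = 0}, p.1.monomial R :=
    tsum_congr fun p => Pairs.weight_of_defect β p.2
  rw [hzero, tsum_weight_eq_tsum_weight_zero β w, tsum_weight_zero_eq_tsum_monomial,
    add_eq_left] at hadd
  rw [← hadd]
  exact (Equiv.subtypeEquivRight fun p => by simp [Nat.pos_iff_ne_zero]).tsum_eq
    (fun p : ↥{p : Pairs w | p.defect = 0}ᶜ => p.1.weight β)

end Topology

end CauchyIdentity

end

/-- `R` is discrete, and power series carry the product topology: a family is summable exactly if
every coefficient vanishes for all but finitely many members, and its sum is the formal sum. -/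
theorem mainTheorem2 {R : Type*} [CommRing R] [TopologicalSpace R] [DiscreteTopology R]
    (β : R) (w : ℕ) :
    -- the generating functions are well defined
    (∀ L : CauchyIdentity.Diagrams w,
      Summable (fun P : CauchyIdentity.SetValuedTableau L.1 =>
        (-CauchyIdentity.const β) ^ P.excess *
          CauchyIdentity.powMonomial (CauchyIdentity.xVar R) P.content) ∧
      Summable (fun Q : CauchyIdentity.ReversePlanePartition L.1 =>
        CauchyIdentity.const β ^ Q.repeats *
          CauchyIdentity.powMonomial (CauchyIdentity.yVar R) Q.columnContent) ∧
      Summable (fun T : CauchyIdentity.ColumnStrictTableau L.1 =>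
        CauchyIdentity.powMonomial (CauchyIdentity.xVar R) T.content) ∧
      Summable (fun T : CauchyIdentity.ColumnStrictTableau L.1 =>
        CauchyIdentity.powMonomial (CauchyIdentity.yVar R) T.content)) ∧
    -- so are both sides of the identity
    Summable (fun L : CauchyIdentity.Diagrams w =>
      CauchyIdentity.grothendieck L.1 (CauchyIdentity.const β) (CauchyIdentity.xVar R) *
        CauchyIdentity.dualGrothendieck L.1 (CauchyIdentity.const β) (CauchyIdentity.yVar R)) ∧
    Summable (fun L : CauchyIdentity.Diagrams w =>
      CauchyIdentity.schur L.1 (CauchyIdentity.xVar R) *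
        CauchyIdentity.schur L.1 (CauchyIdentity.yVar R)) ∧
    -- the identity
    (∑' L : CauchyIdentity.Diagrams w,
        CauchyIdentity.grothendieck L.1 (CauchyIdentity.const β) (CauchyIdentity.xVar R) *
          CauchyIdentity.dualGrothendieck L.1 (CauchyIdentity.const β) (CauchyIdentity.yVar R)) =
      (∑' L : CauchyIdentity.Diagrams w,
        CauchyIdentity.schur L.1 (CauchyIdentity.xVar R) *
          CauchyIdentity.schur L.1 (CauchyIdentity.yVar R)) ∧
    -- the sums over pairs of tableaux, and the cancellation of the pairs with positive defect
    Summable (fun p : CauchyIdentity.Pairs w => p.weight β) ∧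
    (∑' L : CauchyIdentity.Diagrams w,
        CauchyIdentity.grothendieck L.1 (CauchyIdentity.const β) (CauchyIdentity.xVar R) *
          CauchyIdentity.dualGrothendieck L.1 (CauchyIdentity.const β) (CauchyIdentity.yVar R)) =
      (∑' p : CauchyIdentity.Pairs w, p.weight β) ∧
    (∑' p : {p : CauchyIdentity.Pairs w // 0 < p.defect}, p.1.weight β) = 0 ∧
    (∑' p : CauchyIdentity.Pairs w, p.weight β) =
      (∑' p : {p : CauchyIdentity.Pairs w // p.defect = 0}, p.1.weight β) ∧
    (∑' p : {p : CauchyIdentity.Pairs w // p.defect = 0}, p.1.weight β) =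
      (∑' p : {p : CauchyIdentity.Pairs w // p.defect = 0}, p.1.monomial R) ∧
    (∑' p : {p : CauchyIdentity.Pairs w // p.defect = 0}, p.1.monomial R) =
      (∑' L : CauchyIdentity.Diagrams w,
        CauchyIdentity.schur L.1 (CauchyIdentity.xVar R) *
          CauchyIdentity.schur L.1 (CauchyIdentity.yVar R)) := by
  have hG := CauchyIdentity.hasSum_grothendieck_mul_dualGrothendieck β w
  have hS := CauchyIdentity.hasSum_schur_mul_schur (R := R) w
  have hβ := CauchyIdentity.tsum_weight_eq_tsum_weight_zero β w
  have hmono := CauchyIdentity.tsum_weight_zero_eq_tsum_monomial (R := R) w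
  have hdefect : (∑' p : {p : CauchyIdentity.Pairs w // p.defect = 0}, p.1.weight β) =
      ∑' p : {p : CauchyIdentity.Pairs w // p.defect = 0}, p.1.monomial R :=
    tsum_congr fun p => CauchyIdentity.Pairs.weight_of_defect β p.2
  refine ⟨fun L => ⟨?_, ?_, ?_, ?_⟩, hG.summable, hS.summable, ?_, ?_, hG.tsum_eq, ?_, ?_,
    hdefect, ?_⟩
  · exact CauchyIdentity.SetValuedTableau.summable_weight L.1 β Sum.inl_injective
  · exact CauchyIdentity.ReversePlanePartition.summable_weight L.1 β Sum.inr_injective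
  · exact CauchyIdentity.ColumnStrictTableau.summable_powMonomial L.1 Sum.inl_injective
  · exact CauchyIdentity.ColumnStrictTableau.summable_powMonomial L.1 Sum.inr_injective
  · rw [hG.tsum_eq, hS.tsum_eq, hβ]
  · exact CauchyIdentity.Pairs.summable_weight β w
  · exact CauchyIdentity.tsum_weight_defect_pos β w
  · rw [hβ, hmono, hdefect]
  · rw [hS.tsum_eq, hmono]
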